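/- All spaces are compactly generated (products $\times$, smash products $\wedge$, path spaces and loop spaces carry the compactly generated topology). Let $(B,b_0)$ and $(C,c_0)$ be H-spaces, i.e. based spaces with a based multiplication for which the base point is a two-sided unit up to based homotopy; assume that $C$ is homotopy associative. Let $w\colon B\to C$ be a based map (not necessarily an H-map). For a based space $(Y,y_0)$ let $LY$ be the free loop space, $\Omega Y$ the based loop space, $i\colon\Omega Y\to LY$ the inclusion, $s\colon Y\to LY$ the map sending a point to the constant loop, and $Lw\colon LB\to LC$ the map induced by $w$; $LB$ and $LC$ are based at the constant loops at the base points and are H-spaces under pointwise multiplication of loops. Let $E=\{(x,\lambda): x\in B,\ \lambda\colon[0,1]\to C,\ \lambda(0)=c_0,\ \lambda(1)=w(x)\}$ be the homotopy fibre of $w$, with projection $p\colon E\to B$. Let $D\colon LB\wedge LB\to LC$ be a deviation of $Lw$ from being an H-map, i.e. a based map such that the maps $(x,y)\mapsto D(x\wedge y)\cdot Lw(x\cdot y)$ and $(x,y)\mapsto Lw(x)\cdot Lw(y)$ from $LB\times LB$ to $LC$ are based homotopic. Let $d\colon\Omega B\wedge B\to\Omega C$ be a based map with $i\circ d\simeq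 D\circ(i\wedge s)$ by a based homotopy, let $\mathfrak D\colon\Omega B\wedge B\to\Omega C$ be $d$ followed by loop reversal (the inverse of $d$ for loop multiplication), and put $$\mathfrak D'=\mathfrak D\circ(1\wedge p)\colon\ \Omega B\wedge E\to\Omega C .$$ Call a class $a\in H_r(X;\mathbb Z)$ of a based space $X$ primitive if $\Delta_*a=a\times 1+1\times a$ in $H_r(X\times X;\mathbb Z)$, where $\Delta$ is the diagonal and $1$ is the class of the base point. Let $a\in H_{r_1}(\Omega B;\mathbb Z)$ and $b\in H_{r_2}(E;\mathbb Z)$ be primitive classes with $r_1,r_2>0$. Let $\mathfrak D'_*(a\times b)\in H_{r_1+r_2}(\Omega C;\mathbb Z)$ be the image of the cross product $a\times b\in H_{r_1+r_2}(\Omega B\times E;\mathbb Z)$ under $\Omega B\times E\to\Omega B\wedge E\xrightarrow{\mathfrak D'}\Omega C$, and let $(Lw)_*(a\times b)\in H_{r_1+r_2}(LC;\mathbb Z)$ be its image under $$\Omega B\times E\xrightarrow{1\times p}\Omega B\times B\xrightarrow{(\lambda,x)\,\mapsto\, i(\lambda)\cdot s(x)}LB\xrightarrow{Lw}LC .$$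 Then $i_*\bigl(\mathfrak D'_*(a\times b)\bigr)=(Lw)_*(a\times b)$ in $H_{r_1+r_2}(LC;\mathbb Z)$. This holds for every choice of $D$ and $d$ as above. -/

import Mathlib

/-! ### The Eilenberg-Zilber (shuffle) chains of a product of two simplices -/

/-- Integral ordered `n`-chains of a preorder `P`: the free abelian group on the monotone maps
`[n] → P`. -/
abbrev PosetChain (P : Type) [Preorder P] (n : ℕ) : Type := (Fin (n + 1) →o P) →₀ ℤ

namespace PosetChain

variable {P Q R : Type} [PartialOrder P] [PartialOrder Q] [PartialOrder R]

/-- The `k`-th face of an ordered simplex. -/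
def face {n : ℕ} (k : Fin (n + 2)) (f : Fin (n + 2) →o P) : Fin (n + 1) →o P :=
  f.comp (Fin.succAboveOrderEmb k).toOrderHom

/-- The alternating sum of the faces. -/
noncomputable def bdry {n : ℕ} : PosetChain P (n + 1) →ₗ[ℤ] PosetChain P n :=
  Finsupp.lift _ ℤ _ fun f => ∑ k : Fin (n + 2), (-1 : ℤ) ^ (k : ℕ) • Finsupp.single (face k f) 1

/-- Push-forward of chains along a monotone map. -/
noncomputable def push (φ : P →o Q) {n : ℕ} : PosetChain P n →ₗ[ℤ] PosetChain Q n :=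
  Finsupp.lmapDomain ℤ ℤ fun f => φ.comp f

/-- Append the largest element as a last vertex. -/
def snocTop [OrderTop P] {n : ℕ} (f : Fin (n + 1) →o P) : Fin (n + 2) →o P where
  toFun := Fin.snoc (α := fun _ => P) f ⊤
  monotone' := by
    intro i j hij
    refine Fin.lastCases ?_ (fun j => ?_) j hij
    · intro _; simp
    · refine Fin.lastCases ?_ (fun i => ?_) i
      · intro h
        exact absurd (lt_of_lt_of_le (Fin.castSucc_lt_last j) h) (lt_irrefl _)
      · intro h
        simpa using f.monotone (by simpa using h)

@[simp] lemma snocTop_last [OrderTop P] {n : ℕ} (f : Fin (n + 1) →o P) :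
    snocTop f (Fin.last (n + 1)) = ⊤ := Fin.snoc_last (α := fun _ => P) _ _

@[simp] lemma snocTop_castSucc [OrderTop P] {n : ℕ} (f : Fin (n + 1) →o P) (i : Fin (n + 1)) :
    snocTop f i.castSucc = f i := Fin.snoc_castSucc (α := fun _ => P) _ _ _

@[simp] lemma face_apply {n : ℕ} (k : Fin (n + 2)) (f : Fin (n + 2) →o P) (i : Fin (n + 1)) :
    face k f i = f (k.succAbove i) := rfl

/-- The linear extension of `snocTop`. -/
noncomputable def cone [OrderTop P] {n : ℕ} : PosetChain P n →ₗ[ℤ] PosetChain P (n + 1) :=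
  Finsupp.lmapDomain ℤ ℤ snocTop

@[simp] lemma bdry_single {n : ℕ} (f : Fin (n + 2) →o P) :
    bdry (Finsupp.single f 1) = 
      ∑ k : Fin (n + 2), (-1 : ℤ) ^ (k : ℕ) • Finsupp.single (face k f) (1 : ℤ) := by
  simp [bdry]

@[simp] lemma push_single (φ : P →o Q) {n : ℕ} (f : Fin (n + 1) →o P) (c : ℤ) :
    push φ (Finsupp.single f c) = Finsupp.single (φ.comp f) c := by
  simp [push]

@[simp] lemma cone_single [OrderTop P] {n : ℕ} (f : Fin (n + 1) →o P) (c : ℤ) :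
    cone (Finsupp.single f c) = Finsupp.single (snocTop f) c := by
  simp [cone]

lemma hom_ext {M : Type*} [AddCommGroup M] [Module ℤ M] {n : ℕ}
    {α β : PosetChain P n →ₗ[ℤ] M}
    (h : ∀ f, α (Finsupp.single f 1) = β (Finsupp.single f 1)) : α = β := by
  refine Finsupp.lhom_ext' fun f => LinearMap.ext_ring (h f)

lemma push_push (φ : P →o Q) (ψ : Q →o R) {n : ℕ} (z : PosetChain P n) :
    push ψ (push φ z) = push (ψ.comp φ) z := by
  have : (push ψ).comp (push φ) = push (n := n) (ψ.comp φ) := hom_ext fun f => by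
    simp [OrderHom.comp_assoc]
  exact LinearMap.congr_fun this z

lemma bdry_push (φ : P →o Q) {n : ℕ} (z : PosetChain P (n + 1)) :
    bdry (push φ z) = push φ (bdry z) := by
  have : bdry.comp (push φ) = (push φ).comp (bdry (n := n)) := hom_ext fun f => by
    simp [face, OrderHom.comp_assoc]
  exact LinearMap.congr_fun this z

lemma cone_push [OrderTop P] [OrderTop Q] (φ : P →o Q) (hφ : φ ⊤ = ⊤) {n : ℕ}
    (z : PosetChain P n) : cone (push φ z) = push φ (cone z) := by
  have : cone.comp (push φ) = (push φ).comp (cone (n := n)) := hom_ext fun f => by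
    simp only [LinearMap.comp_apply, push_single, cone_single]
    congr 1
    ext i : 2
    refine Fin.lastCases ?_ (fun i => ?_) i <;> simp [hφ]
  exact LinearMap.congr_fun this z

lemma bdry_cone [OrderTop P] {n : ℕ} (z : PosetChain P (n + 1)) :
    bdry (cone z) = cone (bdry z) + (-1 : ℤ) ^ (n + 2) • z := by
  have : bdry.comp (cone (n := n + 1)) =
      (cone (P := P)).comp bdry + (-1 : ℤ) ^ (n + 2) • LinearMap.id := hom_ext fun f => by
    simp only [LinearMap.comp_apply, cone_single, bdry_single, LinearMap.add_apply, map_sum,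
      map_smul, LinearMap.smul_apply, LinearMap.id_apply]
    rw [Fin.sum_univ_castSucc]
    congr 1
    · refine Finset.sum_congr rfl fun k _ => ?_
      congr 2
      ext i : 2
      refine Fin.lastCases ?_ (fun i => ?_) i
      · simp
      · simp only [face_apply, snocTop_castSucc, Fin.castSucc_succAbove_castSucc]
    · simp only [Fin.val_last]
      congr 2
      ext i : 2
      simp
  exact LinearMap.congr_fun this z

lemma bdry_cone_zero [OrderTop P] (f : Fin 1 →o P) :
    bdry (cone (Finsupp.single f (1 : ℤ))) =
      Finsupp.single (OrderHom.const _ ⊤) (1 : ℤ) - Finsupp.single f (1 : ℤ) := by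
  rw [cone_single, bdry_single]; erw [Fin.sum_univ_two]
  have h0 : face 0 (snocTop f) = OrderHom.const _ ⊤ := by
    ext i : 2
    have : i = 0 := Fin.fin_one_eq_zero i
    subst this
    rfl
  have h1 : face 1 (snocTop f) = f := by
    ext i : 2
    have : i = 0 := Fin.fin_one_eq_zero i
    subst this
    rfl
  rw [h0, h1]; simp [sub_eq_add_neg]


/-- The poset `[p] × [q]`. -/
abbrev Grid (p q : ℕ) : Type := Fin (p + 1) × Fin (q + 1)

/-- The map `dⁱ × 1` of grids. -/
def coface₁ {p q : ℕ} (i : Fin (p + 2)) : Grid p q →o Grid (p + 1) q :=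
  OrderHom.prodMap (Fin.succAboveOrderEmb i).toOrderHom OrderHom.id

/-- The map `1 × dʲ` of grids. -/
def coface₂ {p q : ℕ} (j : Fin (q + 2)) : Grid p q →o Grid p (q + 1) :=
  OrderHom.prodMap OrderHom.id (Fin.succAboveOrderEmb j).toOrderHom

/-- The Eilenberg-Zilber chain of `[p] × [q]` (nonzero only in degree `n = p + q`): the sum of all
maximal chains `(0,0) < ⋯ < (p,q)`, with the sign `(-1)ᵏ`, where `k` is the number of pairs made of
a vertical step and a later horizontal step, i.e. the sign of the corresponding shuffle.
It is built by recursion on the last step: a last horizontal step comes after `q` vertical steps,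
whence the sign `(-1)^q`; a last vertical step contributes no sign. -/
noncomputable def ez : (n p q : ℕ) → PosetChain (Grid p q) n
  | 0, p, q => if p = 0 ∧ q = 0 then Finsupp.single (OrderHom.const _ ⊤) 1 else 0
  | n + 1, p, q => cone
      ((match p with
        | 0 => 0
        | p + 1 => (-1 : ℤ) ^ q • push (coface₁ (Fin.last _)) (ez n p q)) +
      (match q with
        | 0 => 0
        | q + 1 => push (coface₂ (Fin.last _)) (ez n p q)))

/-- Chains whose last step is horizontal (before the last vertex is appended). -/
noncomputable def ezA (n : ℕ) : (p q : ℕ) → PosetChain (Grid p q) n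
  | 0, _ => 0
  | p + 1, q => (-1 : ℤ) ^ q • push (coface₁ (Fin.last _)) (ez n p q)

/-- Chains whose last step is vertical (before the last vertex is appended). -/
noncomputable def ezB (n : ℕ) : (p q : ℕ) → PosetChain (Grid p q) n
  | _, 0 => 0
  | p, q + 1 => push (coface₂ (Fin.last _)) (ez n p q)

lemma ez_succ (n p q : ℕ) : ez (n + 1) p q = cone (ezA n p q + ezB n p q) := by
  cases p <;> cases q <;> rfl

/-- The alternating sum of the faces of `[p] × [q]` in the first direction. -/
noncomputable def ezFace₁ (n : ℕ) : (p q : ℕ) → PosetChain (Grid p q) n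
  | 0, _ => 0
  | p + 1, q => ∑ i : Fin (p + 2), (-1 : ℤ) ^ (i : ℕ) • push (coface₁ i) (ez n p q)

/-- The alternating sum of the faces of `[p] × [q]` in the second direction. -/
noncomputable def ezFace₂ (n : ℕ) : (p q : ℕ) → PosetChain (Grid p q) n
  | _, 0 => 0
  | p, q + 1 => ∑ j : Fin (q + 2), (-1 : ℤ) ^ (j : ℕ) • push (coface₂ j) (ez n p q)

lemma coface₁_top {p q : ℕ} (i : Fin (p + 1)) :
    coface₁ (p := p) (q := q) i.castSucc ⊤ = ⊤ := by
  refine Prod.ext ?_ rfl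
  change i.castSucc.succAbove (Fin.last p) = Fin.last _
  rw [Fin.succAbove_of_le_castSucc _ _ (by simpa [Fin.le_def] using Nat.lt_succ_iff.mp i.isLt)]
  rfl

lemma coface₂_top {p q : ℕ} (j : Fin (q + 1)) :
    coface₂ (p := p) (q := q) j.castSucc ⊤ = ⊤ := by
  refine Prod.ext rfl ?_
  change j.castSucc.succAbove (Fin.last q) = Fin.last _
  rw [Fin.succAbove_of_le_castSucc _ _ (by simpa [Fin.le_def] using Nat.lt_succ_iff.mp j.isLt)]
  rfl

lemma ez_eq_zero : ∀ (n p q : ℕ), n ≠ p + q → ez n p q = 0 := by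
  intro n
  induction n with
  | zero =>
    intro p q h
    have : ¬ (p = 0 ∧ q = 0) := by omega
    simp [ez, this]
  | succ n ih =>
    intro p q h
    have hA : ezA n p q = 0 := by
      cases p with
      | zero => rfl
      | succ p => simp [ezA, ih p q (by omega)]
    have hB : ezB n p q = 0 := by
      cases q with
      | zero => rfl
      | succ q => simp [ezB, ih p q (by omega)]
    simp [ez_succ, hA, hB]

lemma coface₁_coface₁ {p q : ℕ} (i : Fin (p + 2)) :
    (coface₁ (q := q) i.castSucc).comp (coface₁ (Fin.last (p + 1))) =
      (coface₁ (Fin.last (p + 2))).comp (coface₁ i) := by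
  ext ⟨a, b⟩ : 2
  refine Prod.ext ?_ rfl
  change i.castSucc.succAbove ((Fin.last (p + 1)).succAbove a) =
    (Fin.last (p + 2)).succAbove (i.succAbove a)
  simp [Fin.castSucc_succAbove_castSucc]

lemma coface₂_coface₂ {p q : ℕ} (i : Fin (q + 2)) :
    (coface₂ (p := p) i.castSucc).comp (coface₂ (Fin.last (q + 1))) =
      (coface₂ (Fin.last (q + 2))).comp (coface₂ i) := by
  ext ⟨a, b⟩ : 2
  refine Prod.ext rfl ?_
  change i.castSucc.succAbove ((Fin.last (q + 1)).succAbove b) =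
    (Fin.last (q + 2)).succAbove (i.succAbove b)
  simp [Fin.castSucc_succAbove_castSucc]

lemma coface₁_coface₂ {p q : ℕ} (i : Fin (p + 2)) (j : Fin (q + 2)) :
    (coface₁ i).comp (coface₂ j) = (coface₂ j).comp (coface₁ i) := rfl

lemma ezFace₁_eq (n p q : ℕ) :
    ezFace₁ n (p + 1) q =
      ∑ i : Fin (p + 1), (-1 : ℤ) ^ (i : ℕ) • push (coface₁ i.castSucc) (ez n p q) +
        (-1 : ℤ) ^ (p + 1) • push (coface₁ (Fin.last _)) (ez n p q) := by
  simp [ezFace₁, Fin.sum_univ_castSucc (n := p + 1)]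

lemma ezFace₂_eq (n p q : ℕ) :
    ezFace₂ n p (q + 1) =
      ∑ i : Fin (q + 1), (-1 : ℤ) ^ (i : ℕ) • push (coface₂ i.castSucc) (ez n p q) +
        (-1 : ℤ) ^ (q + 1) • push (coface₂ (Fin.last _)) (ez n p q) := by
  simp [ezFace₂, Fin.sum_univ_castSucc (n := q + 1)]

lemma inner₁_A (n p q : ℕ) :
    ∑ i : Fin (p + 1), (-1 : ℤ) ^ (i : ℕ) • push (coface₁ i.castSucc) (ezA n p q) =
      (-1 : ℤ) ^ q • push (coface₁ (Fin.last _)) (ezFace₁ n p q) := by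
  cases p with
  | zero => simp [ezA, ezFace₁]
  | succ p =>
    simp only [ezA, ezFace₁, map_sum, map_smul, push_push, coface₁_coface₁, Finset.smul_sum]
    exact Finset.sum_congr rfl fun i _ => smul_comm _ _ _

lemma inner₁_B (n p q : ℕ) :
    ∑ i : Fin (p + 1), (-1 : ℤ) ^ (i : ℕ) • push (coface₁ i.castSucc) (ezB n p (q + 1)) =
      push (coface₂ (Fin.last _)) (ezFace₁ n (p + 1) q) -
        (-1 : ℤ) ^ (p + 1) •
          push ((coface₂ (Fin.last _)).comp (coface₁ (Fin.last _))) (ez n p q) := by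
  rw [ezFace₁_eq]
  simp only [ezB, map_add, map_sum, map_smul, push_push, coface₁_coface₂, add_sub_cancel_right]

lemma inner₂_B (n p q : ℕ) :
    ∑ j : Fin (q + 1), (-1 : ℤ) ^ (j : ℕ) • push (coface₂ j.castSucc) (ezB n p q) =
      push (coface₂ (Fin.last _)) (ezFace₂ n p q) := by
  cases q with
  | zero => simp [ezB, ezFace₂]
  | succ q => simp only [ezB, ezFace₂, map_sum, map_smul, push_push, coface₂_coface₂]

lemma inner₂_A (n p q : ℕ) :
    ∑ j : Fin (q + 1), (-1 : ℤ) ^ (j : ℕ) • push (coface₂ j.castSucc) (ezA n (p + 1) q) =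
      (-1 : ℤ) ^ q • push (coface₁ (Fin.last _)) (ezFace₂ n p (q + 1)) +
          push ((coface₂ (Fin.last _)).comp (coface₁ (Fin.last _))) (ez n p q) := by
  rw [ezFace₂_eq]
  simp only [ezA, map_add, map_sum, map_smul, push_push, coface₁_coface₂, smul_add, Finset.smul_sum,
    smul_smul]
  have : (-1 : ℤ) ^ q * (-1) ^ (q + 1) = -1 := by
    rw [pow_succ, ← mul_assoc, ← mul_pow]; simp
  simp only [this, neg_smul, one_smul, neg_add_cancel_right]
  exact Finset.sum_congr rfl fun i _ => by rw [mul_comm]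

lemma inner₁ (n p q : ℕ) :
    ∑ i : Fin (p + 1), (-1 : ℤ) ^ (i : ℕ) • push (coface₁ i.castSucc) (ez (n + 1) p q) =
      cone (∑ i : Fin (p + 1), (-1 : ℤ) ^ (i : ℕ) • push (coface₁ i.castSucc) (ezA n p q) +
        ∑ i : Fin (p + 1), (-1 : ℤ) ^ (i : ℕ) • push (coface₁ i.castSucc) (ezB n p q)) := by
  rw [← Finset.sum_add_distrib, map_sum]
  refine Finset.sum_congr rfl fun i _ => ?_
  rw [ez_succ, ← cone_push _ (coface₁_top i), ← smul_add, map_smul, map_add]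

lemma inner₂ (n p q : ℕ) :
    ∑ j : Fin (q + 1), (-1 : ℤ) ^ (j : ℕ) • push (coface₂ j.castSucc) (ez (n + 1) p q) =
      cone (∑ j : Fin (q + 1), (-1 : ℤ) ^ (j : ℕ) • push (coface₂ j.castSucc) (ezA n p q) +
        ∑ j : Fin (q + 1), (-1 : ℤ) ^ (j : ℕ) • push (coface₂ j.castSucc) (ezB n p q)) := by
  rw [← Finset.sum_add_distrib, map_sum]
  refine Finset.sum_congr rfl fun i _ => ?_
  rw [ez_succ, ← cone_push _ (coface₂_top i), ← smul_add, map_smul, map_add]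

/-- The boundary of `[p] × [q]`. -/
lemma bdry_ez (n p q : ℕ) (h : n + 1 = p + q) :
    bdry (ez (n + 1) p q) = ezFace₁ n p q + (-1 : ℤ) ^ p • ezFace₂ n p q := by
  induction n generalizing p q with
  | zero =>
    have key : ∀ {p q : ℕ} (φ : Grid 0 0 →o Grid p q) (ψ : Grid 0 0 →o Grid p q), ψ ⊤ = ⊤ →
        bdry (cone (push φ (ez 0 0 0))) = push ψ (ez 0 0 0) - push φ (ez 0 0 0) := by
      intro p q φ ψ hψ
      simp only [ez, and_self, if_true, push_single]
      rw [bdry_cone_zero]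
      congr 2
      ext i : 2
      exact hψ.symm
    obtain ⟨rfl, rfl⟩ | ⟨rfl, rfl⟩ : (p = 1 ∧ q = 0) ∨ (p = 0 ∧ q = 1) := by omega
    · rw [ez_succ]
      simp only [ezA, ezB, ezFace₁, ezFace₂, pow_zero, one_smul, add_zero, smul_zero]
      rw [key _ (coface₁ 0) (coface₁_top (p := 0) 0)]
      simp [Fin.sum_univ_two, sub_eq_add_neg]
    · rw [ez_succ]
      simp only [ezA, ezB, ezFace₁, ezFace₂, pow_zero, one_smul, zero_add]
      rw [key _ (coface₂ 0) (coface₂_top (q := 0) 0)]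
      simp [Fin.sum_univ_two, sub_eq_add_neg]
  | succ n ih =>
    rw [ez_succ, bdry_cone]
    have hs : ∀ m k : ℕ, m % 2 = k % 2 → (-1 : ℤ) ^ m = (-1) ^ k := by
      intro m k h
      rw [neg_one_pow_eq_pow_mod_two, h, ← neg_one_pow_eq_pow_mod_two]
    cases p with
    | zero =>
      cases q with
      | zero => omega
      | succ q =>
        rw [ezFace₂_eq, inner₂, inner₂_B]
        simp only [ezA, ezB, ezFace₁, zero_add, bdry_push]
        rw [ih 0 q (by omega)]
        have : n + 2 = q + 1 := by omega
        simp [ezFace₁, this]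
    | succ p =>
      cases q with
      | zero =>
        rw [ezFace₁_eq, inner₁, inner₁_A]
        simp only [ezA, ezB, ezFace₂, pow_zero, one_smul, add_zero, bdry_push]
        rw [ih p 0 (by omega)]
        have : n + 2 = p + 1 := by omega
        simp [ezFace₂, this]
      | succ q =>
        rw [ezFace₁_eq, ezFace₂_eq, inner₁, inner₁_A, inner₁_B, inner₂, inner₂_B, inner₂_A]
        simp only [ezA, ezB, map_add, map_smul, bdry_push]
        rw [ih p (q + 1) (by omega), ih (p + 1) q (by omega)]
        have h1 : (-1 : ℤ) ^ (n + 2) = (-1) ^ (p + q) := hs _ _ (by omega)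
        simp only [map_add, map_sub, map_smul, h1, smul_add, smul_smul,
          pow_add, pow_one]
        rcases neg_one_pow_eq_or ℤ p with hp | hp <;> rcases neg_one_pow_eq_or ℤ q with hq | hq <;>
          simp only [hp, hq] <;> module

end PosetChain

universe u v

/-! ### The homology cross product of simplicial sets -/

namespace SimplicialCross

open CategoryTheory Limits Simplicial MonoidalCategory

/-- The coefficient group `ℤ` (in universe `u`). -/
abbrev Zcoef : AddCommGrpCat.{u} := AddCommGrpCat.of (ULift.{u} ℤ)

/-- Integral simplicial chains of a simplicial set. -/
noncomputable abbrev Cx (S : SSet.{u}) : ChainComplex AddCommGrpCat.{u} ℕ := S.chainComplex Zcoef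

/-- The basis chain given by a simplex. -/
noncomputable def gen {S : SSet.{u}} {n : ℕ} (x : S _⦋n⦌) : (Cx S).X n :=
  (S.ιChainComplex (R := Zcoef) x).hom ⟨1⟩

/-- Chains are free on simplices. -/
noncomputable def lift {S : SSet.{u}} {n : ℕ} {M : Type u} [AddCommGroup M]
    (φ : S _⦋n⦌ → M) : (Cx S).X n →+ M :=
  ((S.isColimitChainComplexXCofan Zcoef n).desc (Cofan.mk (AddCommGrpCat.of M) fun x =>
    AddCommGrpCat.ofHom ((zmultiplesHom M (φ x)).comp
      (AddEquiv.ulift.toAddMonoidHom : ULift.{u} ℤ →+ ℤ)))).hom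

lemma lift_gen {S : SSet.{u}} {n : ℕ} {M : Type u} [AddCommGroup M]
    (φ : S _⦋n⦌ → M) (x : S _⦋n⦌) : lift φ (gen x) = φ x := by
  have h := (S.isColimitChainComplexXCofan Zcoef n).fac (Cofan.mk (AddCommGrpCat.of M) fun x =>
    AddCommGrpCat.ofHom ((zmultiplesHom M (φ x)).comp
      (AddEquiv.ulift.toAddMonoidHom : ULift.{u} ℤ →+ ℤ))) ⟨x⟩
  have h' := congrArg (fun f => f.hom ⟨1⟩) h
  exact h'.trans (one_zsmul (φ x))

lemma hom_ext {S : SSet.{u}} {n : ℕ} {M : Type u} [AddCommGroup M]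
    {α β : (Cx S).X n →+ M} (h : ∀ x : S _⦋n⦌, α (gen x) = β (gen x)) : α = β := by
  have : AddCommGrpCat.ofHom α = AddCommGrpCat.ofHom β := by
    refine SSet.chainComplex_hom_ext fun x => ?_
    ext ⟨r⟩
    have hr : (⟨r⟩ : ULift.{u} ℤ) = r • ⟨1⟩ := by ext; simp
    have := h x
    simp only [gen] at this
    simp only [AddCommGrpCat.hom_comp, AddCommGrpCat.hom_ofHom, AddMonoidHom.comp_apply]
    rw [hr, map_zsmul, map_zsmul, map_zsmul, this]
  exact congrArg AddCommGrpCat.Hom.hom this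

lemma d_gen {S : SSet.{u}} {n : ℕ} (x : S _⦋n + 1⦌) :
    ((Cx S).d (n + 1) n).hom (gen x) =
      ∑ i : Fin (n + 2), (-1 : ℤ) ^ (i : ℕ) • gen (S.δ i x) := by
  have h := congrArg (fun f => f.hom ⟨1⟩) (S.ιChainComplex_d Zcoef x)
  refine Eq.trans h ?_
  change AddCommGrpCat.homAddEquiv (∑ i : Fin (n + 2), _) _ = _
  rw [map_sum, AddMonoidHom.finsetSum_apply]
  refine Finset.sum_congr rfl fun i _ => ?_
  rw [map_zsmul]
  rfl

lemma map_gen {S T : SSet.{u}} (f : S ⟶ T) {n : ℕ} (x : S _⦋n⦌) :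
    ((SSet.chainComplexMap f Zcoef).f n).hom (gen x) = gen (f.app _ x) :=
  congrArg (fun f => f.hom ⟨1⟩) (SSet.ι_chainComplexMap_f (f := f) (R := Zcoef) (x := x))

/-- The `n`-simplex of `S × T` obtained from `x : Δ[p] → S`, `y : Δ[q] → T` and `f : [n] → [p] × [q]`. -/
def gridSimplex {S T : SSet.{u}} {p q n : ℕ} (x : S _⦋p⦌) (y : T _⦋q⦌)
    (f : Fin (n + 1) →o PosetChain.Grid p q) : (S ⊗ T : SSet.{u}) _⦋n⦌ :=
  (S.map (SimplexCategory.mkHom (OrderHom.fst.comp f)).op x,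
    T.map (SimplexCategory.mkHom (OrderHom.snd.comp f)).op y)

/-- The image under `x × y` of chains of `[p] × [q]`. -/
noncomputable def realize {S T : SSet.{u}} {p q : ℕ} (n : ℕ) (x : S _⦋p⦌) (y : T _⦋q⦌) :
    PosetChain (PosetChain.Grid p q) n →+ (Cx (S ⊗ T)).X n :=
  Finsupp.liftAddHom fun f => zmultiplesHom _ (gen (gridSimplex x y f))

lemma realize_single {S T : SSet.{u}} {p q : ℕ} (n : ℕ) (x : S _⦋p⦌) (y : T _⦋q⦌)
    (f : Fin (n + 1) →o PosetChain.Grid p q) :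
    realize n x y (Finsupp.single f 1) = gen (gridSimplex x y f) := by
  rw [realize, Finsupp.liftAddHom_apply_single, zmultiplesHom_apply, one_zsmul]

lemma chain_hom_ext {P : Type} [PartialOrder P] {M : Type*} [AddCommGroup M] {n : ℕ}
    {α β : PosetChain P n →+ M}
    (h : ∀ f, α (Finsupp.single f 1) = β (Finsupp.single f 1)) : α = β :=
  Finsupp.addHom_ext' fun f => AddMonoidHom.ext_int (h f)

lemma d_realize {S T : SSet.{u}} {p q : ℕ} (n : ℕ) (x : S _⦋p⦌) (y : T _⦋q⦌)
    (z : PosetChain (PosetChain.Grid p q) (n + 1)) :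
    ((Cx (S ⊗ T)).d (n + 1) n).hom (realize (n + 1) x y z) =
      realize n x y (PosetChain.bdry z) := by
  have : ((Cx (S ⊗ T)).d (n + 1) n).hom.comp (realize (n + 1) x y) =
      (realize n x y).comp PosetChain.bdry.toAddMonoidHom := chain_hom_ext fun f => by
    change ((Cx (S ⊗ T)).d (n + 1) n).hom (realize (n + 1) x y (Finsupp.single f 1)) =
      realize n x y (PosetChain.bdry (Finsupp.single f 1))
    rw [realize_single, PosetChain.bdry_single, d_gen, map_sum]
    refine Finset.sum_congr rfl fun i _ => ?_
    rw [map_zsmul, realize_single]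
    congr 2
    refine Prod.ext ?_ ?_
    · change S.map _ (S.map _ x) = _
      rw [← Functor.map_comp_apply]
      rfl
    · change T.map _ (T.map _ y) = _
      rw [← Functor.map_comp_apply]
      rfl
  exact DFunLike.congr_fun this z

lemma realize_push₁ {S T : SSet.{u}} {p q : ℕ} (n : ℕ) (x : S _⦋p + 1⦌) (y : T _⦋q⦌)
    (i : Fin (p + 2)) (z : PosetChain (PosetChain.Grid p q) n) :
    realize n x y (PosetChain.push (PosetChain.coface₁ i) z) = realize n (S.δ i x) y z := by
  have : (realize n x y).comp (PosetChain.push (PosetChain.coface₁ i)).toAddMonoidHom =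
      realize n (S.δ i x) y := chain_hom_ext fun f => by
    change realize n x y (PosetChain.push (PosetChain.coface₁ i) (Finsupp.single f 1)) = _
    rw [PosetChain.push_single, realize_single, realize_single]
    congr 1
    refine Prod.ext ?_ rfl
    change _ = S.map _ (S.map _ x)
    rw [← Functor.map_comp_apply]
    rfl
  exact DFunLike.congr_fun this z

lemma realize_push₂ {S T : SSet.{u}} {p q : ℕ} (n : ℕ) (x : S _⦋p⦌) (y : T _⦋q + 1⦌)
    (j : Fin (q + 2)) (z : PosetChain (PosetChain.Grid p q) n) :
    realize n x y (PosetChain.push (PosetChain.coface₂ j) z) = realize n x (T.δ j y) z := by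
  have : (realize n x y).comp (PosetChain.push (PosetChain.coface₂ j)).toAddMonoidHom =
      realize n x (T.δ j y) := chain_hom_ext fun f => by
    change realize n x y (PosetChain.push (PosetChain.coface₂ j) (Finsupp.single f 1)) = _
    rw [PosetChain.push_single, realize_single, realize_single]
    congr 1
    refine Prod.ext rfl ?_
    change _ = T.map _ (T.map _ y)
    rw [← Functor.map_comp_apply]
    rfl
  exact DFunLike.congr_fun this z

/-- The Eilenberg-Zilber cross product of chains: `x × y` is the signed sum over all shuffles. -/
noncomputable def crossChain {S T : SSet.{u}} (n p q : ℕ) :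
    (Cx S).X p →+ (Cx T).X q →+ (Cx (S ⊗ T)).X n :=
  lift fun x => lift fun y => realize n x y (PosetChain.ez n p q)

lemma crossChain_gen {S T : SSet.{u}} (n : ℕ) {p q : ℕ} (x : S _⦋p⦌) (y : T _⦋q⦌) :
    crossChain n p q (gen x) (gen y) = realize n x y (PosetChain.ez n p q) := by
  rw [crossChain, lift_gen, lift_gen]

/-- The Leibniz rule `∂(α × β) = ∂α × β + (-1)^p α × ∂β`. -/
lemma crossChain_d {S T : SSet.{u}} (n p q : ℕ) (h : n + 1 = p + q)
    (α : (Cx S).X p) (β : (Cx T).X q) :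
    ((Cx (S ⊗ T)).d (n + 1) n).hom (crossChain (n + 1) p q α β) =
      crossChain n (p - 1) q (((Cx S).d p (p - 1)).hom α) β +
        (-1 : ℤ) ^ p • crossChain n p (q - 1) α (((Cx T).d q (q - 1)).hom β) := by
  have key : (crossChain (n + 1) p q).compr₂ ((Cx (S ⊗ T)).d (n + 1) n).hom =
      (crossChain n (p - 1) q).comp ((Cx S).d p (p - 1)).hom +
        (-1 : ℤ) ^ p • (crossChain n p (q - 1)).compl₂ ((Cx T).d q (q - 1)).hom := by
    refine hom_ext fun x => hom_ext fun y => ?_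
    change ((Cx (S ⊗ T)).d (n + 1) n).hom (crossChain (n + 1) p q (gen x) (gen y)) =
      crossChain n (p - 1) q (((Cx S).d p (p - 1)).hom (gen x)) (gen y) +
        (-1 : ℤ) ^ p • crossChain n p (q - 1) (gen x) (((Cx T).d q (q - 1)).hom (gen y))
    rw [crossChain_gen, d_realize, PosetChain.bdry_ez n p q h, map_add, map_zsmul]
    congr 1
    · cases p with
      | zero =>
        rw [(Cx S).shape 0 (0 - 1) (by simp)]
        simp [PosetChain.ezFace₁]
      | succ p =>
        change _ = crossChain n p q (((Cx S).d (p + 1) p).hom (gen x)) (gen y)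
        rw [d_gen]
        simp only [PosetChain.ezFace₁, map_sum, map_zsmul, realize_push₁,
          AddMonoidHom.finsetSum_apply]
        refine Finset.sum_congr rfl fun i _ => ?_
        rw [← crossChain_gen]
        rfl
    · congr 1
      cases q with
      | zero =>
        rw [(Cx T).shape 0 (0 - 1) (by simp)]
        simp [PosetChain.ezFace₂]
      | succ q =>
        change _ = crossChain n p q (gen x) (((Cx T).d (q + 1) q).hom (gen y))
        rw [d_gen]
        simp only [PosetChain.ezFace₂, map_sum, map_zsmul, realize_push₂, crossChain_gen]
  exact DFunLike.congr_fun (DFunLike.congr_fun key α) β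

/-! Homology classes of cycles -/

section
variable (K : ChainComplex AddCommGrpCat.{u} ℕ)

/-- The subgroup of cycles. -/
def cyc (n : ℕ) : AddSubgroup (K.X n) := (K.d n (n - 1)).hom.ker

lemma next_nat (n : ℕ) : (ComplexShape.down ℕ).next n = n - 1 := by
  cases n <;> simp

lemma cyc_incl_d (n : ℕ) :
    AddCommGrpCat.ofHom (cyc K n).subtype ≫ K.d n (n - 1) = 0 := by
  ext z
  exact z.2

/-- Cycles as elements of `K.cycles n`. -/
noncomputable def toCyc (n : ℕ) : AddCommGrpCat.of (cyc K n) ⟶ K.cycles n :=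
  K.liftCycles (AddCommGrpCat.ofHom (cyc K n).subtype) (n - 1) (next_nat n) (cyc_incl_d K n)

/-- The homology class of a cycle. -/
noncomputable def toH (n : ℕ) : cyc K n →+ K.homology n :=
  (toCyc K n ≫ K.homologyπ n).hom

lemma iCycles_injective (n : ℕ) : Function.Injective (K.iCycles n).hom :=
  (AddCommGrpCat.mono_iff_injective _).1 inferInstance

lemma iCycles_toCyc {n : ℕ} (z : cyc K n) : (K.iCycles n).hom ((toCyc K n).hom z) = z :=
  congrArg (fun f => f.hom z) (K.liftCycles_i (AddCommGrpCat.ofHom (cyc K n).subtype) (n - 1)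
    (next_nat n) (cyc_incl_d K n))

lemma toH_surjective (n : ℕ) : Function.Surjective (toH K n) := by
  intro a
  obtain ⟨c, rfl⟩ := (AddCommGrpCat.epi_iff_surjective (K.homologyπ n)).1 inferInstance a
  refine ⟨⟨(K.iCycles n).hom c, ?_⟩, ?_⟩
  · exact congrArg (fun f => f.hom c) (K.iCycles_d n (n - 1))
  · change (K.homologyπ n).hom ((toCyc K n).hom _) = _
    congr 1
    apply iCycles_injective
    rw [iCycles_toCyc]

lemma toH_eq_zero_iff {n : ℕ} (z : cyc K n) :
    toH K n z = 0 ↔ ∃ y, (K.d (n + 1) n).hom y = z := by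
  have ex := ShortComplex.exact_of_g_is_cokernel
    (ShortComplex.mk (K.toCycles (n + 1) n) (K.homologyπ n) (by simp))
    (K.homologyIsCokernel (n + 1) n (by simp))
  rw [ShortComplex.ab_exact_iff] at ex
  have hi : ∀ y, (K.iCycles n).hom ((K.toCycles (n + 1) n).hom y) = (K.d (n + 1) n).hom y :=
    fun y => congrArg (fun f => f.hom y) (K.toCycles_i (n + 1) n)
  constructor
  · intro h
    obtain ⟨y, hy⟩ := ex ((toCyc K n).hom z) h
    refine ⟨y, ?_⟩
    rw [← hi, ← iCycles_toCyc K z]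
    exact congrArg _ hy
  · rintro ⟨y, hy⟩
    have : (toCyc K n).hom z = (K.toCycles (n + 1) n).hom y := by
      apply iCycles_injective
      rw [iCycles_toCyc, hi, hy]
    change (K.homologyπ n).hom ((toCyc K n).hom z) = 0
    rw [this]
    exact congrArg (fun f => f.hom y) (K.toCycles_comp_homologyπ (n + 1) n)

end

lemma crossChain_mem_cyc {S T : SSet.{u}} {p q : ℕ} (α : cyc (Cx S) p) (β : cyc (Cx T) q) :
    crossChain (p + q) p q α.1 β.1 ∈ cyc (Cx (S ⊗ T)) (p + q) := by
  change ((Cx (S ⊗ T)).d (p + q) (p + q - 1)).hom _ = 0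
  have hα : ((Cx S).d p (p - 1)).hom α.1 = 0 := α.2
  have hβ : ((Cx T).d q (q - 1)).hom β.1 = 0 := β.2
  obtain hn | ⟨n, hn⟩ : p + q = 0 ∨ ∃ n, n + 1 = p + q := by
    cases h : p + q <;> simp
  · rw [(Cx (S ⊗ T)).shape _ _ (by simp [hn])]
    rfl
  · rw [← hn]
    change ((Cx (S ⊗ T)).d (n + 1) n).hom _ = 0
    rw [crossChain_d n p q hn, hα, hβ, map_zero, map_zero, AddMonoidHom.zero_apply, smul_zero,
      add_zero]

/-- The cross product of cycles. -/
noncomputable def crossCyc {S T : SSet.{u}} {p q : ℕ} :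
    cyc (Cx S) p →+ cyc (Cx T) q →+ cyc (Cx (S ⊗ T)) (p + q) :=
  AddMonoidHom.mk' (fun α => AddMonoidHom.mk'
      (fun β => ⟨crossChain (p + q) p q α.1 β.1, crossChain_mem_cyc α β⟩)
      (fun β β' => Subtype.ext (map_add (crossChain (p + q) p q α.1) β.1 β'.1)))
    (fun α α' => AddMonoidHom.ext fun β => Subtype.ext
      (DFunLike.congr_fun (map_add (crossChain (p + q) p q) α.1 α'.1) β.1))

/-- The homology cross product, computed on representing cycles; by `cross_toH` it does not depend
on the representatives. -/
noncomputable def cross {S T : SSet.{u}} {p q : ℕ}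
    (a : (Cx S).homology p) (b : (Cx T).homology q) : (Cx (S ⊗ T)).homology (p + q) :=
  toH _ _ (crossCyc (Function.surjInv (toH_surjective _ p) a)
    (Function.surjInv (toH_surjective _ q) b))

/-- `[α] × [β] = [α × β]`. -/
lemma cross_toH {S T : SSet.{u}} {p q : ℕ} (α : cyc (Cx S) p) (β : cyc (Cx T) q) :
    cross (toH _ p α) (toH _ q β) = toH _ (p + q) (crossCyc α β) := by
  have hl : ∀ (α α' : cyc (Cx S) p) (β : cyc (Cx T) q), toH _ p α = toH _ p α' →
      toH _ (p + q) (crossCyc α β) = toH _ (p + q) (crossCyc α' β) := by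
    intro α α' β h
    obtain ⟨y, hy⟩ := (toH_eq_zero_iff _ (α - α')).1 (by rw [map_sub, h, sub_self])
    rw [← sub_eq_zero, ← map_sub, ← AddMonoidHom.sub_apply, ← map_sub, toH_eq_zero_iff]
    refine ⟨crossChain (p + q + 1) (p + 1) q y β.1, ?_⟩
    rw [crossChain_d (p + q) (p + 1) q (by omega)]
    have hβ : ((Cx T).d q (q - 1)).hom β.1 = 0 := β.2
    rw [hβ, map_zero, smul_zero, add_zero]
    change crossChain (p + q) p q (((Cx S).d (p + 1) p).hom y) β.1 = _
    rw [hy]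
    rfl
  have hr : ∀ (α : cyc (Cx S) p) (β β' : cyc (Cx T) q), toH _ q β = toH _ q β' →
      toH _ (p + q) (crossCyc α β) = toH _ (p + q) (crossCyc α β') := by
    intro α β β' h
    obtain ⟨y, hy⟩ := (toH_eq_zero_iff _ (β - β')).1 (by rw [map_sub, h, sub_self])
    rw [← sub_eq_zero, ← map_sub, ← map_sub, toH_eq_zero_iff]
    refine ⟨(-1 : ℤ) ^ p • crossChain (p + q + 1) p (q + 1) α.1 y, ?_⟩
    rw [map_zsmul, crossChain_d (p + q) p (q + 1) (by omega)]
    have hα : ((Cx S).d p (p - 1)).hom α.1 = 0 := α.2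
    rw [hα, map_zero, AddMonoidHom.zero_apply, zero_add, smul_smul, ← mul_pow]
    simp only [mul_neg, mul_one, neg_neg, one_pow, one_smul]
    change crossChain (p + q) p q α.1 (((Cx T).d (q + 1) q).hom y) = _
    rw [hy]
    rfl
  unfold cross
  rw [hl _ α _ (Function.surjInv_eq (toH_surjective (Cx S) p) _),
    hr _ _ β (Function.surjInv_eq (toH_surjective (Cx T) q) _)]

end SimplicialCross

/-! ### Compactly generated spaces, loop spaces, smash products -/

namespace KSpace

open Topology unitInterval CategoryTheory MonoidalCategory AlgebraicTopology

/-- The compact Hausdorff spaces, which generate the topology of a compactly generated space. -/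
abbrev testFamily : CompHaus.{u} → Type u := fun K => K

/-- `X` with the compactly generated topology (the `k`-ification of `X`). -/
abbrev Kify (X : Type u) [TopologicalSpace X] : Type u := WithGeneratedByTopology testFamily.{u} X

lemma isGeneratedBy_compHaus (K : CompHaus.{u}) : IsGeneratedBy testFamily.{u} K :=
  inferInstanceAs (IsGeneratedBy testFamily.{u} (testFamily K))

instance (priority := low) (X : Type u) [TopologicalSpace X] [CompactlyGeneratedSpace X] :
    IsGeneratedBy testFamily.{u} X where
  continuous_equiv_symm := by
    refine continuous_from_compactlyGeneratedSpace _ fun K _ _ _ f hf => ?_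
    exact (IsGeneratedBy.equiv_symm_comp_continuous_iff (X := testFamily.{u}) (Y := CompHaus.of K) f).2 hf

instance : IsGeneratedBy testFamily.{u} I :=
  IsQuotientMap.isGeneratedBy (Y := ULift.{u} I) (f := ULift.down) Homeomorph.ulift.isQuotientMap

/-- A point of `X` as a point of `Kify X`. -/
def kmk {X : Type u} [TopologicalSpace X] (x : X) : Kify X :=
  (WithGeneratedByTopology.equiv (X := testFamily.{u})).symm x

/-- A point of `Kify X` as a point of `X`. -/
def kval {X : Type u} [TopologicalSpace X] (x : Kify X) : X :=
  WithGeneratedByTopology.equiv (X := testFamily.{u}) x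

section
variable {A : Type v} [TopologicalSpace A] [IsGeneratedBy testFamily.{u} A]
  {X Y Z W : Type u} [TopologicalSpace X] [TopologicalSpace Y]
  [TopologicalSpace Z] [TopologicalSpace W]

/-- A map from a compactly generated space to `X` is continuous into `Kify X`. -/
def toKify (f : C(A, X)) : C(A, Kify X) :=
  ⟨fun a => kmk (f a),
    (IsGeneratedBy.equiv_symm_comp_continuous_iff (X := testFamily.{u}) _).2 f.continuous⟩

/-- The identity map `Kify X → X`. -/
def fromKify (X : Type u) [TopologicalSpace X] : C(Kify X, X) :=
  ⟨kval, WithGeneratedByTopology.continuous_equiv⟩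

/-- `Kify` on maps. -/
def kmap (f : C(X, Y)) : C(Kify X, Kify Y) := toKify (f.comp (fromKify X))

/-- The product in the category of compactly generated spaces. -/
abbrev KProd (X Y : Type u) [TopologicalSpace X] [TopologicalSpace Y] : Type u := Kify (X × Y)

/-- First projection. -/
def kfst : C(KProd X Y, X) := ContinuousMap.fst.comp (fromKify (X × Y))
/-- Second projection. -/
def ksnd : C(KProd X Y, Y) := ContinuousMap.snd.comp (fromKify (X × Y))

/-- The map into the product with components `f` and `g`. -/
def kpair (f : C(A, X)) (g : C(A, Y)) : C(A, KProd X Y) := toKify (f.prodMk g)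

lemma continuous_of_test {F : A → C(I, Y)}
    (h : ∀ (S : CompHaus.{u}) (g : C(S, A)), Continuous fun x : S × I => F (g x.1) x.2) :
    Continuous F := by
  refine (IsGeneratedBy.continuous_iff testFamily.{u} F).2 fun S g => ?_
  exact (ContinuousMap.curry ⟨fun x : S × I => F (g x.1) x.2, h S g⟩).continuous

end

section
variable (Y : Type u) [TopologicalSpace Y]

/-- The free loop space `LY`, with the compactly generated compact-open topology. -/
abbrev FreeLoop : Type u := Kify {γ : C(I, Y) // γ 0 = γ 1}

/-- The based loop space `ΩY`, with the compactly generated compact-open topology. -/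
abbrev BasedLoop (y₀ : Y) : Type u := Kify (Path y₀ y₀)

variable {Y}

/-- The section `s : Y → LY` given by the constant loops. -/
def constLoop [IsGeneratedBy testFamily.{u} Y] : C(Y, FreeLoop Y) :=
  toKify ⟨fun y => ⟨ContinuousMap.const I y, rfl⟩, by
    refine Continuous.subtype_mk ?_ _
    exact ContinuousMap.continuous_const'⟩

/-- The inclusion `i : ΩY → LY`. -/
def loopIncl (y₀ : Y) : C(BasedLoop Y y₀, FreeLoop Y) :=
  kmap ⟨fun γ => ⟨γ.toContinuousMap, γ.source.trans γ.target.symm⟩, by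
    refine Continuous.subtype_mk ?_ _
    exact continuous_induced_dom⟩

/-- The inverse (path reversal) on `ΩY`. -/
def loopInv (y₀ : Y) : C(BasedLoop Y y₀, BasedLoop Y y₀) :=
  kmap ⟨Path.symm, continuous_induced_rng.2
    ((ContinuousMap.continuous_precomp ⟨unitInterval.symm, by fun_prop⟩).comp
      continuous_induced_dom)⟩

/-- The constant loop, the base point of `ΩY`. -/
def basedConst (y₀ : Y) : BasedLoop Y y₀ := kmk (Path.refl y₀)

/-- The map `Lw : LY → LZ` induced by `w : Y → Z`. -/
def freeMap {Z : Type u} [TopologicalSpace Z] (w : C(Y, Z)) : C(FreeLoop Y, FreeLoop Z) :=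
  kmap ⟨fun γ => ⟨w.comp γ.1, congrArg w γ.2⟩, by
    refine Continuous.subtype_mk ?_ _
    exact (ContinuousMap.continuous_postcomp w).comp continuous_subtype_val⟩

/-- The pointwise product of two paths. -/
def pointwise (μ : C(KProd Y Y, Y)) (γ δ : C(I, Y)) : C(I, Y) := μ.comp (kpair γ δ)

/-- The pointwise multiplication on `LY` induced by a multiplication on `Y`. -/
def freeMul (μ : C(KProd Y Y, Y)) : C(KProd (FreeLoop Y) (FreeLoop Y), FreeLoop Y) :=
  toKify ⟨fun x => ⟨pointwise μ (kval (kfst x)).1 (kval (ksnd x)).1, by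
      simp [pointwise, kpair, toKify, (kval (kfst x)).2, (kval (ksnd x)).2]⟩, by
    refine Continuous.subtype_mk (continuous_of_test fun S g => ?_) _
    have ev : ∀ f : C(S, FreeLoop Y), Continuous fun x : S × I => (kval (f x.1)).1 x.2 := by
      intro f
      exact ContinuousMap.continuous_uncurry_of_continuous
        ⟨fun s => (kval (f s)).1,
          continuous_subtype_val.comp ((fromKify _).continuous.comp f.continuous)⟩
    have : IsGeneratedBy testFamily.{u} (S × I) := isGeneratedBy_compHaus (CompHaus.of (S × I))
    exact (μ.comp (kpair ⟨_, ev (kfst.comp g)⟩ ⟨_, ev (ksnd.comp g)⟩)).continuous⟩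

end

/-! Smash products -/
section
variable {X X' Y Y' : Type u} [TopologicalSpace X] [TopologicalSpace Y] [TopologicalSpace X']
  [TopologicalSpace Y']

/-- The subspace `X ∨ Y = X × {y₀} ∪ {x₀} × Y` of `X × Y`. -/
def InWedge (x₀ : X) (y₀ : Y) (p : KProd X Y) : Prop := kfst p = x₀ ∨ ksnd p = y₀

/-- The smash product `X ∧ Y`: the quotient of `X × Y` that collapses `X ∨ Y` to a point. -/
def Smash (x₀ : X) (y₀ : Y) : Type u :=
  Quot fun p q : KProd X Y => InWedge x₀ y₀ p ∧ InWedge x₀ y₀ q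

instance (x₀ : X) (y₀ : Y) : TopologicalSpace (Smash x₀ y₀) :=
  inferInstanceAs (TopologicalSpace (Quot _))

/-- The quotient map `X × Y → X ∧ Y`. -/
def smashMk (x₀ : X) (y₀ : Y) : C(KProd X Y, Smash x₀ y₀) := ⟨Quot.mk _, continuous_quot_mk⟩

/-- The base point of `X ∧ Y`. -/
def smashBase (x₀ : X) (y₀ : Y) : Smash x₀ y₀ := smashMk x₀ y₀ (kmk (x₀, y₀))

lemma smashMap_aux {x₀ : X} {y₀ : Y} {x₀' : X'} {y₀' : Y'} (f : C(X, X')) (g : C(Y, Y'))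
    (hf : f x₀ = x₀') (hg : g y₀ = y₀') (p q : KProd X Y)
    (h : InWedge x₀ y₀ p ∧ InWedge x₀ y₀ q) :
    InWedge x₀' y₀' (kpair (f.comp kfst) (g.comp ksnd) p) ∧
      InWedge x₀' y₀' (kpair (f.comp kfst) (g.comp ksnd) q) := by
  have key : ∀ p, InWedge x₀ y₀ p →
      InWedge x₀' y₀' (kpair (f.comp kfst) (g.comp ksnd) p) := by
    rintro p (h | h)
    · exact Or.inl ((congrArg f h).trans hf)
    · exact Or.inr ((congrArg g h).trans hg)
  exact ⟨key p h.1, key q h.2⟩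

/-- The map `f ∧ g` of smash products induced by based maps `f` and `g`. -/
def smashMap {x₀ : X} {y₀ : Y} {x₀' : X'} {y₀' : Y'} (f : C(X, X')) (g : C(Y, Y'))
    (hf : f x₀ = x₀') (hg : g y₀ = y₀') : C(Smash x₀ y₀, Smash x₀' y₀') :=
  ⟨Quot.map (kpair (f.comp kfst) (g.comp ksnd)) (smashMap_aux f g hf hg),
    continuous_quot_lift _ (continuous_quot_mk.comp (ContinuousMap.continuous _))⟩

end

/-! ### H-spaces and the deviation from being an H-map -/
section
variable {X : Type u} [TopologicalSpace X] [IsGeneratedBy testFamily.{u} X]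

/-- An H-space structure on the based space `(X, x₀)` (in the category of compactly generated spaces):
a based multiplication for which `x₀` is a two-sided unit up to based homotopy. -/
structure HStructure (X : Type u) [TopologicalSpace X] [IsGeneratedBy testFamily.{u} X] (x₀ : X) where
  mul : C(KProd X X, X)
  mul_base : mul (kmk (x₀, x₀)) = x₀
  const_mul : (mul.comp (kpair (ContinuousMap.const X x₀) (ContinuousMap.id X))).HomotopicRel
    (ContinuousMap.id X) {x₀}
  mul_const : (mul.comp (kpair (ContinuousMap.id X) (ContinuousMap.const X x₀))).HomotopicRel
    (ContinuousMap.id X) {x₀}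

/-- Homotopy associativity: `(xy)z ≃ x(yz)` by a based homotopy. -/
def HStructure.HomotopyAssoc {x₀ : X} (h : HStructure X x₀) : Prop :=
  (h.mul.comp (kpair (h.mul.comp kfst) ksnd)).HomotopicRel
    (h.mul.comp (kpair (kfst.comp kfst) (h.mul.comp (kpair (ksnd.comp kfst) ksnd))))
    {(kmk (kmk (x₀, x₀), x₀) : KProd (KProd X X) X)}

end

section
variable {B C : Type u} [TopologicalSpace B] [TopologicalSpace C]
  [IsGeneratedBy testFamily.{u} B] [IsGeneratedBy testFamily.{u} C]

/-- The homotopy fibre `E` of `w : B → C`, the total space of the principal fibration with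
classifying map `w`: pairs of a point `b` and a path in `C` from `c₀` to `w b`. -/
abbrev HomotopyFibre (w : C(B, C)) (c₀ : C) : Type u :=
  Kify {x : B × C(I, C) // x.2 0 = c₀ ∧ x.2 1 = w x.1}

/-- The principal fibration `p : E → B`. -/
def fibreProj (w : C(B, C)) (c₀ : C) : C(HomotopyFibre w c₀, B) :=
  (ContinuousMap.fst.comp ⟨Subtype.val, continuous_subtype_val⟩).comp (fromKify _)

/-- The base point of `E`. -/
def fibreBase (w : C(B, C)) {b₀ : B} {c₀ : C} (hw : w b₀ = c₀) : HomotopyFibre w c₀ :=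
  kmk ⟨(b₀, ContinuousMap.const I c₀), rfl, hw.symm⟩

variable {b₀ : B} {c₀ : C}

/-- `D : LB ∧ LB → LC` is a deviation of `Lw : LB → LC` from being an H-map: a based map with
`D(x ∧ y) · Lw(x · y) ≃ Lw(x) · Lw(y)` by a based homotopy of maps `LB × LB → LC`. -/
structure IsDeviation (hB : HStructure B b₀) (hC : HStructure C c₀) (w : C(B, C))
    (D : C(Smash (constLoop b₀) (constLoop b₀), FreeLoop C)) : Prop where
  base : D (smashBase _ _) = constLoop c₀
  homotopic : ((freeMul hC.mul).comp (kpair (D.comp (smashMk _ _))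
        ((freeMap w).comp (freeMul hB.mul)))).HomotopicRel
      ((freeMul hC.mul).comp (kpair ((freeMap w).comp kfst) ((freeMap w).comp ksnd)))
      {kmk (constLoop b₀, constLoop b₀)}

lemma loopIncl_basedConst (y₀ : B) : loopIncl y₀ (basedConst y₀) = constLoop y₀ := rfl

/-- `d : ΩB ∧ B → ΩC` lifts the composite of `i ∧ s : ΩB ∧ B → LB ∧ LB` and `D : LB ∧ LB → LC`
through `i : ΩC → LC`, up to based homotopy. -/
structure IsLoopLift (D : C(Smash (constLoop b₀) (constLoop b₀), FreeLoop C))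
    (d : C(Smash (basedConst b₀) b₀, BasedLoop C c₀)) : Prop where
  base : d (smashBase _ _) = basedConst c₀
  homotopic : ((loopIncl c₀).comp d).HomotopicRel
    (D.comp (smashMap (loopIncl b₀) constLoop rfl rfl)) {smashBase _ _}

/-- The map `𝔇 : ΩB ∧ B → ΩC`: the inverse, for the multiplication of loops, of the lift `d`. -/
def frakD (d : C(Smash (basedConst b₀) b₀, BasedLoop C c₀)) :
    C(Smash (basedConst b₀) b₀, BasedLoop C c₀) :=
  (loopInv c₀).comp d

/-- The map `𝔇' = 𝔇 ∘ (1 ∧ p) : ΩB ∧ E → ΩC`. -/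
def frakDPrime (w : C(B, C)) (hw : w b₀ = c₀) (d : C(Smash (basedConst b₀) b₀, BasedLoop C c₀)) :
    C(Smash (basedConst b₀) (fibreBase w hw), BasedLoop C c₀) :=
  (frakD d).comp (smashMap (ContinuousMap.id _) (fibreProj w c₀) rfl rfl)

/-- The map `ΩB × B → LB` that multiplies `i : ΩB → LB` and `s : B → LB`. -/
def prodToFree (hB : HStructure B b₀) : C(KProd (BasedLoop B b₀) B, FreeLoop B) :=
  (freeMul hB.mul).comp (kpair ((loopIncl b₀).comp kfst) (constLoop.comp ksnd))

end

/-! ### Singular homology, cross products and primitive classes -/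

/-- Singular homology `H_n(X; ℤ)`. -/
noncomputable abbrev homologyZ (n : ℕ) (X : Type u) [TopologicalSpace X] : AddCommGrpCat.{u} :=
  ((singularHomologyFunctor AddCommGrpCat.{u} n).obj SimplicialCross.Zcoef).obj (TopCat.of X)

/-- The map induced in homology. -/
noncomputable def homologyZMap (n : ℕ) {X Y : Type u} [TopologicalSpace X] [TopologicalSpace Y]
    (f : C(X, Y)) : homologyZ n X →+ homologyZ n Y :=
  (((singularHomologyFunctor AddCommGrpCat.{u} n).obj SimplicialCross.Zcoef).map
    (TopCat.ofHom f)).hom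

instance (n : SimplexCategory) : IsGeneratedBy testFamily.{u} (SimplexCategory.toTop.{u}.obj n) :=
  isGeneratedBy_compHaus (CompHaus.of (ULift.{u} (stdSimplex ℝ (Fin (n.len + 1)))))

/-- The simplicial map `Sing X × Sing Y → Sing (X × Y)`. -/
noncomputable def singProd (X Y : Type u) [TopologicalSpace X] [TopologicalSpace Y] :
    TopCat.toSSet.obj (TopCat.of X) ⊗ TopCat.toSSet.obj (TopCat.of Y) ⟶
      TopCat.toSSet.obj (TopCat.of (KProd X Y)) where
  app n := ↾fun s => ⟨TopCat.ofHom
    (kpair (A := SimplexCategory.toTop.{u}.obj n.unop) s.1.down.hom s.2.down.hom)⟩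
  naturality _ _ _ := rfl

/-- The homology cross product `H_p(X; ℤ) × H_q(Y; ℤ) → H_{p+q}(X × Y; ℤ)`. -/
noncomputable def homologyCross {X Y : Type u} [TopologicalSpace X] [TopologicalSpace Y] {p q : ℕ}
    (a : homologyZ p X) (b : homologyZ q Y) : homologyZ (p + q) (KProd X Y) :=
  (SSet.homologyMap (singProd X Y) SimplicialCross.Zcoef (p + q)).hom (SimplicialCross.cross a b)

/-- A class `a` is primitive if `Δ_* a = a × 1 + 1 × a` in the homology of `X × X`, where `1` is the
class of the base point, so that `a × 1` and `1 × a` are the images of `a` under `x ↦ (x, x₀)` and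
`x ↦ (x₀, x)`. -/
def IsPrimitive {X : Type u} [TopologicalSpace X] [IsGeneratedBy testFamily.{u} X] (x₀ : X) {n : ℕ}
    (a : homologyZ n X) : Prop :=
  homologyZMap n (kpair (ContinuousMap.id X) (ContinuousMap.id X)) a =
    homologyZMap n (kpair (ContinuousMap.id X) (ContinuousMap.const X x₀)) a +
      homologyZMap n (kpair (ContinuousMap.const X x₀) (ContinuousMap.id X)) a

end KSpace

open KSpace

/-! Write `φ(λ, e) = Lw(λ · p(e))` and `ψ(λ) = Lw(λ)` for maps from `ΩB × E` to `LC`, and let `k` be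
`d` pulled back to `ΩB × E`. Pulling the deviation identity back along `i × sp` gives `k · φ ≃ ψ ·
Lw(s p(e))`. The last factor is the constant loop at `w p(e)`, and `w ∘ p` is null homotopic on the
homotopy fibre, so `k · φ ≃ ψ`. The pointwise product of a reversed based loop with the loop itself
is null homotopic (`loopMul_loopInv_self`). Multiplying on the left by the reverse of `k` and using
homotopy associativity therefore yields `φ ≃ 𝔇' · ψ` (`freeMap_prodToFree_homotopic`).

In the product `𝔇'(λ, e) · ψ(λ)` the loop `λ` occurs twice, so this map is the diagonal of `ΩB`
followed by a map `F` on `ΩB × ΩB × E`. Since `a` is primitive, the image of `a × b` is the sum of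
its images under the restrictions of `F` to the two axes (`IsPrimitive.homologyZMap_homologyCross`).
On one axis `ψ` is constant and `𝔇'` remains up to homotopy. On the other `𝔇'` is constant, so the
restriction depends on `λ` alone and kills `a × b`, because `b` has positive degree.

Homology does not see base points, so free homotopies suffice throughout. -/

namespace SimplicialCross

open CategoryTheory Limits Simplicial MonoidalCategory

/-! ### Naturality and additivity of the simplicial cross product. -/

/-- The map induced on cycles by a chain map. -/
noncomputable def mapCyc {S T : SSet.{u}} (f : S ⟶ T) (n : ℕ) (z : cyc (Cx S) n) :
    cyc (Cx T) n :=
  ⟨((SSet.chainComplexMap f Zcoef).f n).hom z.1, by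
    have h := congrArg (fun g => g.hom z.1) ((SSet.chainComplexMap f Zcoef).comm n (n - 1))
    have hz : ((Cx S).d n (n - 1)).hom z.1 = 0 := z.2
    change ((Cx T).d n (n - 1)).hom _ = 0
    refine h.trans ?_
    change ((SSet.chainComplexMap f Zcoef).f (n - 1)).hom (((Cx S).d n (n - 1)).hom z.1) = 0
    rw [hz, map_zero]⟩

/-- Reduces computations in homology to representing cycles. Two elements of `cycles` agree once
their underlying chains do, since `iCycles` is injective. -/
lemma homologyMap_toH {S T : SSet.{u}} (f : S ⟶ T) {n : ℕ} (z : cyc (Cx S) n) :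
    (SSet.homologyMap f Zcoef n).hom (toH _ n z) = toH _ n (mapCyc f n z) := by
  have h := congrArg (fun g => g.hom ((toCyc (Cx S) n).hom z))
    (HomologicalComplex.homologyπ_naturality (SSet.chainComplexMap f Zcoef) n)
  refine h.trans ?_
  change ((Cx T).homologyπ n).hom _ = ((Cx T).homologyπ n).hom _
  congr 1
  apply iCycles_injective
  refine Eq.trans ?_ (iCycles_toCyc (Cx T) (mapCyc f n z)).symm
  have h' := congrArg (fun g => g.hom ((toCyc (Cx S) n).hom z))
    (HomologicalComplex.cyclesMap_i (SSet.chainComplexMap f Zcoef) n)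
  refine h'.trans ?_
  change ((SSet.chainComplexMap f Zcoef).f n).hom (((Cx S).iCycles n).hom _) = _
  rw [iCycles_toCyc]
  rfl

/-- The simplices `gridSimplex x y c` arise from `x` and `y` by simplicial operators, and simplicial
maps commute with these. -/
lemma map_realize {S T S' T' : SSet.{u}} (f : S ⟶ S') (g : T ⟶ T') {p q : ℕ} (n : ℕ)
    (x : S _⦋p⦌) (y : T _⦋q⦌) (z : PosetChain (PosetChain.Grid p q) n) :
    ((SSet.chainComplexMap (f ⊗ₘ g) Zcoef).f n).hom (realize n x y z) =
      realize n (f.app _ x) (g.app _ y) z := by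
  have : ((SSet.chainComplexMap (f ⊗ₘ g) Zcoef).f n).hom.comp (realize n x y) =
      realize n (f.app _ x) (g.app _ y) := chain_hom_ext fun c => by
    rw [AddMonoidHom.comp_apply, realize_single, realize_single, map_gen]
    congr 1
    refine Prod.ext ?_ ?_
    · exact NatTrans.naturality_apply f _ x
    · exact NatTrans.naturality_apply g _ y
  exact DFunLike.congr_fun this z

lemma map_crossChain {S T S' T' : SSet.{u}} (f : S ⟶ S') (g : T ⟶ T') (n p q : ℕ)
    (α : (Cx S).X p) (β : (Cx T).X q) :
    ((SSet.chainComplexMap (f ⊗ₘ g) Zcoef).f n).hom (crossChain n p q α β) =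
      crossChain n p q (((SSet.chainComplexMap f Zcoef).f p).hom α)
        (((SSet.chainComplexMap g Zcoef).f q).hom β) := by
  have key : (crossChain n p q).compr₂ ((SSet.chainComplexMap (f ⊗ₘ g) Zcoef).f n).hom =
      ((crossChain n p q).comp ((SSet.chainComplexMap f Zcoef).f p).hom).compl₂
        ((SSet.chainComplexMap g Zcoef).f q).hom := by
    refine hom_ext fun x => hom_ext fun y => ?_
    change ((SSet.chainComplexMap (f ⊗ₘ g) Zcoef).f n).hom (crossChain n p q (gen x) (gen y)) =
      crossChain n p q (((SSet.chainComplexMap f Zcoef).f p).hom (gen x))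
        (((SSet.chainComplexMap g Zcoef).f q).hom (gen y))
    rw [crossChain_gen, map_realize, map_gen, map_gen, crossChain_gen]
  exact DFunLike.congr_fun (DFunLike.congr_fun key α) β

/-- The homology cross product is natural. -/
lemma map_cross {S T S' T' : SSet.{u}} (f : S ⟶ S') (g : T ⟶ T') {p q : ℕ}
    (a : (Cx S).homology p) (b : (Cx T).homology q) :
    (SSet.homologyMap (f ⊗ₘ g) Zcoef (p + q)).hom (cross a b) =
      cross ((SSet.homologyMap f Zcoef p).hom a) ((SSet.homologyMap g Zcoef q).hom b) := by
  obtain ⟨α, rfl⟩ := toH_surjective _ _ a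
  obtain ⟨β, rfl⟩ := toH_surjective _ _ b
  rw [cross_toH, homologyMap_toH, homologyMap_toH, homologyMap_toH, cross_toH]
  congr 1
  exact Subtype.ext (map_crossChain f g _ _ _ α.1 β.1)

/-- The topological cross product is the simplicial one followed by `singProd`; the maps `s` and
`s'` leave room for it. -/
lemma map_map_cross {S T S' T' U U' : SSet.{u}} (f : S ⟶ S') (g : T ⟶ T') (s : S ⊗ T ⟶ U)
    (s' : S' ⊗ T' ⟶ U') (k : U ⟶ U') (e : s ≫ k = (f ⊗ₘ g) ≫ s') {p q : ℕ}
    (a : (Cx S).homology p) (b : (Cx T).homology q) :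
    (SSet.homologyMap k Zcoef (p + q)).hom ((SSet.homologyMap s Zcoef (p + q)).hom (cross a b)) =
      (SSet.homologyMap s' Zcoef (p + q)).hom
        (cross ((SSet.homologyMap f Zcoef p).hom a) ((SSet.homologyMap g Zcoef q).hom b)) := by
  have h := congrArg
    (fun l : (S ⊗ T : SSet.{u}) ⟶ U' => (SSet.homologyMap l Zcoef (p + q)).hom (cross a b)) e
  rw [SSet.homologyMap_comp, SSet.homologyMap_comp] at h
  refine Eq.trans h ?_
  exact congrArg (SSet.homologyMap s' Zcoef (p + q)).hom (map_cross f g a b)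

/-- `cross` is defined through chosen representatives, so additivity is not visible from the
definition; `cross_toH` permits taking the sum of the two cycles as representative of the sum. -/
lemma cross_add_left {S T : SSet.{u}} {p q : ℕ} (a a' : (Cx S).homology p)
    (b : (Cx T).homology q) : cross (a + a') b = cross a b + cross a' b := by
  obtain ⟨α, rfl⟩ := toH_surjective _ _ a
  obtain ⟨α', rfl⟩ := toH_surjective _ _ a'
  obtain ⟨β, rfl⟩ := toH_surjective _ _ b
  rw [← map_add, cross_toH, cross_toH, cross_toH, map_add, AddMonoidHom.add_apply, map_add]

lemma cross_zero_right {S T : SSet.{u}} {p q : ℕ} (a : (Cx S).homology p) :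
    cross a (0 : (Cx T).homology q) = 0 := by
  obtain ⟨α, rfl⟩ := toH_surjective _ _ a
  rw [← map_zero (toH (Cx T) q), cross_toH, map_zero, map_zero]

end SimplicialCross

namespace KSpace

open Topology unitInterval CategoryTheory MonoidalCategory AlgebraicTopology

/-! ### Singular homology of products and primitive classes. -/

section
variable {X Y Z X' Y' : Type u} [TopologicalSpace X] [TopologicalSpace Y] [TopologicalSpace Z]
  [TopologicalSpace X'] [TopologicalSpace Y']

lemma homologyZMap_comp (n : ℕ) (g : C(Y, Z)) (f : C(X, Y)) (a : homologyZ n X) :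
    homologyZMap n (g.comp f) a = homologyZMap n g (homologyZMap n f a) := by
  have := (((singularHomologyFunctor AddCommGrpCat.{u} n).obj SimplicialCross.Zcoef).map_comp
    (TopCat.ofHom f) (TopCat.ofHom g))
  exact congrArg (fun h => h.hom a) this

lemma homologyZMap_congr (n : ℕ) {f g : C(X, Y)} (h : f.Homotopic g) :
    homologyZMap n f = homologyZMap n g := by
  obtain ⟨H⟩ := h
  exact congrArg AddCommGrpCat.Hom.hom
    (TopCat.Homotopy.congr_homologyMap_singularChainComplexFunctor
      (f := TopCat.ofHom f) (g := TopCat.ofHom g) H SimplicialCross.Zcoef n)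

/-- Constant maps are zero in positive degrees. -/
lemma homologyZMap_const {n : ℕ} (hn : 0 < n) (y : Y) (a : homologyZ n X) :
    homologyZMap n (ContinuousMap.const X y) a = 0 := by
  -- A constant map factors through a point, which has no homology in positive degrees.
  have h : homologyZMap n (ContinuousMap.const X (PUnit.unit : PUnit.{u + 1})) a = 0 := by
    have hz := isZero_singularHomologyFunctor_of_totallyDisconnectedSpace AddCommGrpCat.{u} n
      SimplicialCross.Zcoef (TopCat.of PUnit.{u + 1}) hn.ne'
    exact (AddCommGrpCat.subsingleton_of_isZero hz).elim _ _
  have e : ContinuousMap.const X y = (ContinuousMap.const PUnit.{u + 1} y).comp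
    (ContinuousMap.const X PUnit.unit) := rfl
  rw [e, homologyZMap_comp, h, map_zero]

/-- The homology cross product is natural. -/
lemma homologyZMap_homologyCross (f : C(X, X')) (g : C(Y, Y')) {p q : ℕ}
    (a : homologyZ p X) (b : homologyZ q Y) :
    homologyZMap (p + q) (kpair (f.comp kfst) (g.comp ksnd)) (homologyCross a b) =
      homologyCross (homologyZMap p f a) (homologyZMap q g b) := by
  -- On a pair of singular simplices `(σ, τ)` both composites are the pair of `f ∘ σ` and `g ∘ τ`.
  have e : singProd X Y ≫ TopCat.toSSet.map (TopCat.ofHom (kpair (f.comp kfst) (g.comp ksnd))) =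
    (TopCat.toSSet.map (TopCat.ofHom f) ⊗ₘ TopCat.toSSet.map (TopCat.ofHom g)) ≫
      singProd X' Y' := by
    refine NatTrans.ext (funext fun n => ?_)
    ext x
    rfl
  exact SimplicialCross.map_map_cross _ _ _ _ _ e a b

lemma homologyCross_add_left {p q : ℕ} (a a' : homologyZ p X) (b : homologyZ q Y) :
    homologyCross (a + a') b = homologyCross a b + homologyCross a' b := by
  exact (congrArg (SSet.homologyMap (singProd X Y) SimplicialCross.Zcoef (p + q)).hom
    (SimplicialCross.cross_add_left (S := TopCat.toSSet.obj (TopCat.of X))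
      (T := TopCat.toSSet.obj (TopCat.of Y)) a a' b)).trans (map_add _ _ _)

lemma homologyCross_zero_right {p q : ℕ} (a : homologyZ p X) :
    homologyCross a (0 : homologyZ q Y) = 0 := by
  exact (congrArg (SSet.homologyMap (singProd X Y) SimplicialCross.Zcoef (p + q)).hom
    (SimplicialCross.cross_zero_right (S := TopCat.toSSet.obj (TopCat.of X))
      (T := TopCat.toSSet.obj (TopCat.of Y)) a)).trans (map_zero _)

/-- A map on `X × Y` that factors through the projection to `X` kills `a × b` when `b` has positive
degree. -/
lemma homologyZMap_comp_kfst_homologyCross {p q : ℕ} (hq : 0 < q) [IsGeneratedBy testFamily.{u} X]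
    (f : C(X, Z)) (a : homologyZ p X) (b : homologyZ q Y) :
    homologyZMap (p + q) (f.comp kfst) (homologyCross a b) = 0 := by
  -- Replacing `Y` by a point does not change the map, and by naturality it replaces `b` by its
  -- image in the homology of a point.
  have e : f.comp (kfst (X := X) (Y := Y)) = (f.comp (kfst (Y := PUnit.{u + 1}))).comp
    (kpair ((ContinuousMap.id X).comp kfst) ((ContinuousMap.const Y PUnit.unit).comp ksnd)) := rfl
  rw [e, homologyZMap_comp, homologyZMap_homologyCross, homologyZMap_const hq,
    homologyCross_zero_right, map_zero]

/-- If `a` is primitive and `F` is a map on `X × X × Y`, the composite of `F` with the diagonal of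
`X` takes `a × b` to the sum of its images under the two restrictions of `F` to axes of
`X × X`. -/
lemma IsPrimitive.homologyZMap_homologyCross [IsGeneratedBy testFamily.{u} X] {x₀ : X} {p q : ℕ}
    {a : homologyZ p X} (ha : IsPrimitive x₀ a) (b : homologyZ q Y)
    (F : C(KProd (KProd X X) Y, Z)) :
    homologyZMap (p + q) (F.comp (kpair (kpair kfst kfst) ksnd)) (homologyCross a b) =
      homologyZMap (p + q) (F.comp (kpair (kpair kfst (ContinuousMap.const _ x₀)) ksnd))
          (homologyCross a b) +
        homologyZMap (p + q) (F.comp (kpair (kpair (ContinuousMap.const _ x₀) kfst) ksnd))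
          (homologyCross a b) := by
  -- All three maps have the form `F ∘ (j × 1)`, with `j` the diagonal or an axis inclusion.
  -- Naturality lets `j` act on `a` alone, where primitivity applies.
  have key : ∀ j : C(X, KProd X X),
      homologyZMap (p + q) (F.comp (kpair (j.comp kfst) ksnd)) (homologyCross a b) =
        homologyZMap (p + q) F (homologyCross (homologyZMap p j a)
          (homologyZMap q (ContinuousMap.id Y) b)) := fun j => by
    rw [homologyZMap_comp, ← KSpace.homologyZMap_homologyCross]
    rfl
  have h := key (kpair (ContinuousMap.id X) (ContinuousMap.id X))
  rw [show homologyZMap p (kpair (ContinuousMap.id X) (ContinuousMap.id X)) a = _ from ha,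
    homologyCross_add_left, map_add, ← key, ← key] at h
  exact h

end

/-! ### Free homotopies of maps into `LY` and the pointwise product. -/

section
variable {A : Type u} [TopologicalSpace A] [IsGeneratedBy testFamily.{u} A]

/-- As `I` is compact Hausdorff, the identity `A × I → Kify (A × I)` is adjoint to a map `A → C(I,
Kify (A × I))`, whose continuity can be tested on compact Hausdorff spaces. Hence the ordinary
product with `I` needs no retopologising, and `kpair` accepts homotopies. -/
instance isGeneratedBy_prod_unitInterval : IsGeneratedBy testFamily.{u} (A × I) where
  continuous_equiv_symm := by
    let F : A → C(I, Kify (A × I)) := fun a => ⟨fun t => kmk (a, t),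
      (toKify (A := I) ⟨fun t => ((a, t) : A × I), by fun_prop⟩).continuous⟩
    have hF : Continuous F := continuous_of_test fun S g => by
      have : IsGeneratedBy testFamily.{u} (S × I) := isGeneratedBy_compHaus (CompHaus.of (S × I))
      exact (toKify (A := S × I) ⟨fun x => (g x.1, x.2), by fun_prop⟩).continuous
    exact ContinuousMap.continuous_uncurry_of_continuous ⟨F, hF⟩

instance isGeneratedBy_unitInterval_prod : IsGeneratedBy testFamily.{u} (I × A) :=
  (Homeomorph.prodComm A I).isQuotientMap.isGeneratedBy

variable {Y : Type u} [TopologicalSpace Y]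

/-- The map `A × I → Y` adjoint to a map `A → LY`. -/
def loopEval (f : C(A, FreeLoop Y)) : C(A × I, Y) where
  toFun x := (kval (f x.1)).1 x.2
  continuous_toFun := ContinuousMap.continuous_uncurry_of_continuous
    ⟨fun a => (kval (f a)).1,
      continuous_subtype_val.comp ((fromKify _).continuous.comp f.continuous)⟩

omit [IsGeneratedBy testFamily.{u} A] in
lemma loopEval_closed (f : C(A, FreeLoop Y)) (a : A) : loopEval f (a, 0) = loopEval f (a, 1) :=
  (kval (f a)).2

/-- By adjunction a homotopy into `LY` is a map into `Y` with an additional loop parameter, so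
homotopies can be given by formulas in `Y`. -/
lemma freeLoop_homotopic {f g : C(A, FreeLoop Y)} (H : C((I × A) × I, Y))
    (h₀ : ∀ a t, H ((0, a), t) = loopEval f (a, t))
    (h₁ : ∀ a t, H ((1, a), t) = loopEval g (a, t))
    (hl : ∀ x, H (x, 0) = H (x, 1)) : f.Homotopic g :=
  ⟨{ toContinuousMap := toKify ⟨fun x => ⟨H.curry x, hl x⟩,
        H.curry.continuous.subtype_mk _⟩
     map_zero_left := fun a => congrArg kmk (Subtype.ext (ContinuousMap.ext (h₀ a)))
     map_one_left := fun a => congrArg kmk (Subtype.ext (ContinuousMap.ext (h₁ a))) }⟩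

/-- The pointwise product of two maps into `LY`. -/
def loopMul (μ : C(KProd Y Y, Y)) (f g : C(A, FreeLoop Y)) : C(A, FreeLoop Y) :=
  (freeMul μ).comp (kpair f g)

lemma loopMul_homotopic (μ : C(KProd Y Y, Y)) {f f' g g' : C(A, FreeLoop Y)}
    (hf : f.Homotopic f') (hg : g.Homotopic g') :
    (loopMul μ f g).Homotopic (loopMul μ f' g') := by
  obtain ⟨F⟩ := hf
  obtain ⟨G⟩ := hg
  exact ⟨{ toContinuousMap := loopMul μ F.toContinuousMap G.toContinuousMap
           map_zero_left := fun a => by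
             change freeMul μ (kmk (F (0, a), G (0, a))) = _
             rw [F.apply_zero, G.apply_zero]
             rfl
           map_one_left := fun a => by
             change freeMul μ (kmk (F (1, a), G (1, a))) = _
             rw [F.apply_one, G.apply_one]
             rfl }⟩

variable [IsGeneratedBy testFamily.{u} Y] {y₀ : Y}

/-- The unit homotopy of `Y` is applied at each time of the loop separately; the loops stay closed
because the two ends undergo the same deformation. The right unit and associativity follow in the
same way. -/
lemma loopMul_const_left (h : HStructure Y y₀) (f : C(A, FreeLoop Y)) :
    (loopMul h.mul (ContinuousMap.const A (constLoop y₀)) f).Homotopic f := by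
  obtain ⟨H⟩ := h.const_mul
  refine freeLoop_homotopic ⟨fun x => H (x.1.1, loopEval f (x.1.2, x.2)), by fun_prop⟩ ?_ ?_ ?_
  · exact fun a t => H.apply_zero _
  · exact fun a t => H.apply_one _
  · exact fun x => congrArg (fun y => H (x.1, y)) (loopEval_closed f x.2)

lemma loopMul_const_right (h : HStructure Y y₀) (f : C(A, FreeLoop Y)) :
    (loopMul h.mul f (ContinuousMap.const A (constLoop y₀))).Homotopic f := by
  obtain ⟨H⟩ := h.mul_const
  refine freeLoop_homotopic ⟨fun x => H (x.1.1, loopEval f (x.1.2, x.2)), by fun_prop⟩ ?_ ?_ ?_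
  · exact fun a t => H.apply_zero _
  · exact fun a t => H.apply_one _
  · exact fun x => congrArg (fun y => H (x.1, y)) (loopEval_closed f x.2)

lemma loopMul_assoc (h : HStructure Y y₀) (ha : h.HomotopyAssoc) (f g k : C(A, FreeLoop Y)) :
    (loopMul h.mul (loopMul h.mul f g) k).Homotopic (loopMul h.mul f (loopMul h.mul g k)) := by
  obtain ⟨H⟩ := ha
  let e : C(A × I, KProd (KProd Y Y) Y) := kpair (kpair (loopEval f) (loopEval g)) (loopEval k)
  refine freeLoop_homotopic ⟨fun x => H (x.1.1, e (x.1.2, x.2)), by fun_prop⟩ ?_ ?_ ?_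
  · exact fun a t => H.apply_zero _
  · exact fun a t => H.apply_one _
  · intro x
    refine congrArg (fun y => H (x.1, y)) ?_
    change kmk (kmk (loopEval f (x.2, 0), loopEval g (x.2, 0)), loopEval k (x.2, 0)) =
      kmk (kmk (loopEval f (x.2, 1), loopEval g (x.2, 1)), loopEval k (x.2, 1))
    simp only [loopEval_closed]

/-- The map `A → LY` adjoint to a map `A × I → Y`. -/
def loopOfEval (F : C(A × I, Y)) (hF : ∀ a, F (a, 0) = F (a, 1)) : C(A, FreeLoop Y) :=
  toKify ⟨fun a => ⟨F.curry a, hF a⟩, F.curry.continuous.subtype_mk _⟩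

/-- The pointwise product of the reverse of a based loop with the loop itself is freely
null homotopic. -/
lemma loopMul_loopInv_self (h : HStructure Y y₀) (k : C(A, BasedLoop Y y₀)) :
    (loopMul h.mul ((loopIncl y₀).comp ((loopInv y₀).comp k)) ((loopIncl y₀).comp k)).Homotopic
      (ContinuousMap.const A (constLoop y₀)) := by
  let e : C(A × I, Y) := loopEval ((loopIncl y₀).comp k)
  have e0 : ∀ a, e (a, 0) = y₀ := fun a => (kval (k a)).source
  have e1 : ∀ a, e (a, 1) = y₀ := fun a => (kval (k a)).target
  -- Clamping to `[0, 1]` lets reparametrisations be written as real formulas and makes them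
  -- stationary outside the unit interval.
  let π : C(ℝ, I) := ⟨Set.projIcc 0 1 zero_le_one, continuous_projIcc⟩
  have π0 : ∀ r ≤ 0, π r = 0 := fun r hr => Set.projIcc_of_le_left zero_le_one hr
  have π1 : ∀ r, 1 ≤ r → π r = 1 := fun r hr => Set.projIcc_of_right_le zero_le_one hr
  have πv : ∀ r : I, π r = r := fun r => Set.projIcc_val zero_le_one r
  -- The two factors move one after the other: the reversed loop for `t ≤ 1/2`, the loop itself
  -- afterwards, each resting at `y₀` while the other moves.
  let m₁ : C(A × I, Y) := h.mul.comp (kpair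
    ⟨fun x => e (x.1, π (1 - 2 * (x.2 : ℝ))), by fun_prop⟩
    ⟨fun x => e (x.1, π (2 * (x.2 : ℝ) - 1)), by fun_prop⟩)
  have hm₁ : ∀ a, m₁ (a, 0) = m₁ (a, 1) := fun a => by
    change h.mul (kmk (e (a, π (1 - 2 * ((0 : I) : ℝ))), e (a, π (2 * ((0 : I) : ℝ) - 1)))) =
      h.mul (kmk (e (a, π (1 - 2 * ((1 : I) : ℝ))), e (a, π (2 * ((1 : I) : ℝ) - 1))))
    rw [π1 _ (by simp), π0 _ (by simp), π0 _ (by norm_num), π1 _ (by norm_num), e0, e1]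
  -- This is the concatenation of the reversed loop with the loop: `|1 - 2t|` runs from `1` to `0`
  -- and back.
  let m₂ : C(A × I, Y) := ⟨fun x => e (x.1, π |1 - 2 * (x.2 : ℝ)|), by fun_prop⟩
  have hm₂ : ∀ a, m₂ (a, 0) = m₂ (a, 1) := fun a => by
    change e (a, π |1 - 2 * ((0 : I) : ℝ)|) = e (a, π |1 - 2 * ((1 : I) : ℝ)|)
    norm_num
  obtain ⟨K⟩ := h.const_mul
  obtain ⟨L⟩ := h.mul_const
  -- The unit homotopies are relative to the base point. This is what makes them fit together at `t
  -- = 1/2` and keeps the loops closed below.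
  have Kb : ∀ s, K (s, y₀) = y₀ := fun s => (K.eq_fst s rfl).trans h.mul_base
  have Lb : ∀ s, L (s, y₀) = y₀ := fun s => (L.eq_fst s rfl).trans h.mul_base
  have K0 : ∀ y, K (0, y) = h.mul (kmk (y₀, y)) := fun y => K.apply_zero y
  have L0 : ∀ y, L (0, y) = h.mul (kmk (y, y₀)) := fun y => L.apply_zero y
  have K1 : ∀ y, K (1, y) = y := fun y => K.apply_one y
  have L1 : ∀ y, L (1, y) = y := fun y => L.apply_one y
  refine ContinuousMap.Homotopic.trans (g := loopOfEval m₁ hm₁) ?_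
    (ContinuousMap.Homotopic.trans (g := loopOfEval m₂ hm₂) ?_ ?_)
  -- Linear interpolation from `1 - t` and `t` to the delayed parametrisations in `m₁`. The
  -- endpoints stay fixed, so both factors begin and end at `y₀`; the outer `π` only serves to land
  -- in `I`.
  · let α : C(I × I, I) := ⟨fun x => π ((1 - (x.1 : ℝ)) * (1 - x.2) + x.1 * π (1 - 2 * (x.2 : ℝ))),
      by fun_prop⟩
    let β : C(I × I, I) := ⟨fun x => π ((1 - (x.1 : ℝ)) * x.2 + x.1 * π (2 * (x.2 : ℝ) - 1)),
      by fun_prop⟩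
    have α0 : ∀ t, α (0, t) = σ t := fun t => by
      simpa [α] using πv (σ t)
    have β0 : ∀ t, β (0, t) = t := fun t => by
      simpa [β] using πv t
    have α1 : ∀ t : I, α (1, t) = π (1 - 2 * (t : ℝ)) := fun t => by
      simpa [α] using πv _
    have β1 : ∀ t : I, β (1, t) = π (2 * (t : ℝ) - 1) := fun t => by
      simpa [β] using πv _
    have αs : ∀ s, α (s, 0) = 1 ∧ α (s, 1) = 0 := fun s => by
      have h0 : (π (1 - 2 * ((0 : I) : ℝ)) : I) = 1 := π1 _ (by simp)
      have h1 : (π (1 - 2 * ((1 : I) : ℝ)) : I) = 0 := π0 _ (by norm_num)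
      constructor
      · change π _ = _
        simp only [h0]
        exact π1 _ (by simp)
      · change π _ = _
        simp only [h1]
        exact π0 _ (by simp)
    have βs : ∀ s, β (s, 0) = 0 ∧ β (s, 1) = 1 := fun s => by
      have h0 : (π (2 * ((0 : I) : ℝ) - 1) : I) = 0 := π0 _ (by simp)
      have h1 : (π (2 * ((1 : I) : ℝ) - 1) : I) = 1 := π1 _ (by norm_num)
      constructor
      · change π _ = _
        simp only [h0]
        exact π0 _ (by simp)
      · change π _ = _
        simp only [h1]
        exact π1 _ (by simp)
    refine freeLoop_homotopic (h.mul.comp (kpair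
      ⟨fun x => e (x.1.2, α (x.1.1, x.2)), by fun_prop⟩
      ⟨fun x => e (x.1.2, β (x.1.1, x.2)), by fun_prop⟩)) (fun a t => ?_) (fun a t => ?_)
      fun x => ?_
    · change h.mul (kmk (e (a, α (0, t)), e (a, β (0, t)))) = _
      rw [α0, β0]
      rfl
    · change h.mul (kmk (e (a, α (1, t)), e (a, β (1, t)))) = _
      rw [α1, β1]
      rfl
    · change h.mul (kmk (e (x.2, α (x.1, 0)), e (x.2, β (x.1, 0)))) =
        h.mul (kmk (e (x.2, α (x.1, 1)), e (x.2, β (x.1, 1))))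
      rw [(αs _).1, (αs _).2, (βs _).1, (βs _).2, e0, e1]
  -- For `t ≤ 1/2` the right factor rests at `y₀`, so the right unit homotopy `L` removes it; for
  -- later `t` the left factor rests and `K` applies. Both factors are at `y₀` when `t = 1/2`.
  · refine freeLoop_homotopic ⟨fun x => if (x.2 : ℝ) ≤ 1 / 2 then
        L (x.1.1, e (x.1.2, π (1 - 2 * (x.2 : ℝ)))) else
        K (x.1.1, e (x.1.2, π (2 * (x.2 : ℝ) - 1))), ?_⟩ (fun a t => ?_) (fun a t => ?_)
      fun x => ?_
    · refine Continuous.if_le (by fun_prop) (by fun_prop) (by fun_prop) (by fun_prop) ?_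
      intro x hx
      rw [π0 _ (by rw [hx]; norm_num), π0 _ (by rw [hx]; norm_num), e0, Kb, Lb]
    · change _ = h.mul (kmk (e (a, π (1 - 2 * (t : ℝ))), e (a, π (2 * (t : ℝ) - 1))))
      by_cases ht : (t : ℝ) ≤ 1 / 2
      · rw [π0 (2 * (t : ℝ) - 1) (by linarith), e0, ← L0]
        exact if_pos ht
      · rw [π0 (1 - 2 * (t : ℝ)) (by linarith), e0, ← K0]
        exact if_neg ht
    · change _ = e (a, π |1 - 2 * (t : ℝ)|)
      by_cases ht : (t : ℝ) ≤ 1 / 2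
      · rw [abs_of_nonneg (by linarith), ← L1 (e _)]
        exact if_pos ht
      · rw [abs_of_nonpos (by linarith), neg_sub, ← K1 (e _)]
        exact if_neg ht
    · change (if ((0 : I) : ℝ) ≤ 1 / 2 then L (x.1, e (x.2, π (1 - 2 * ((0 : I) : ℝ)))) else _) =
        (if ((1 : I) : ℝ) ≤ 1 / 2 then _ else K (x.1, e (x.2, π (2 * ((1 : I) : ℝ) - 1))))
      rw [if_pos (by simp), if_neg (by norm_num), π1 _ (by simp), π1 _ (by norm_num), e1, Kb, Lb]
  -- The path backtracks along itself, so it contracts by turning around earlier and earlier: at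
  -- stage `s` it goes back only to time `s`.
  · refine freeLoop_homotopic ⟨fun x => e (x.1.2, π (max (x.1.1 : ℝ) |1 - 2 * (x.2 : ℝ)|)),
      by fun_prop⟩ (fun a t => ?_) (fun a t => ?_) fun x => ?_
    · change e (a, π (max ((0 : I) : ℝ) _)) = e (a, π |1 - 2 * (t : ℝ)|)
      rw [max_eq_right (by simp)]
    · change e (a, π (max ((1 : I) : ℝ) _)) = y₀
      rw [π1 (max ((1 : I) : ℝ) _) (le_max_left _ _), e1]
    · change e (x.2, π (max (x.1 : ℝ) |1 - 2 * ((0 : I) : ℝ)|)) =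
        e (x.2, π (max (x.1 : ℝ) |1 - 2 * ((1 : I) : ℝ)|))
      norm_num

end

/-! ### The deviation identity on `ΩB × E`. -/

section
variable {B C : Type u} [TopologicalSpace B] [TopologicalSpace C]
  [IsGeneratedBy testFamily.{u} B] [IsGeneratedBy testFamily.{u} C] {b₀ : B} {c₀ : C}

omit [IsGeneratedBy testFamily.{u} B] [IsGeneratedBy testFamily.{u} C] in
/-- The composite `w ∘ p : E → B → C` is null homotopic. -/
lemma comp_fibreProj_homotopic (w : C(B, C)) (c₀ : C) :
    (w.comp (fibreProj w c₀)).Homotopic (ContinuousMap.const _ c₀) := by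
  let e : C(HomotopyFibre w c₀ × I, C) := ⟨fun x => (kval x.1).1.2 x.2,
    ContinuousMap.continuous_uncurry_of_continuous
      ⟨fun x : HomotopyFibre w c₀ => (kval x).1.2,
        continuous_snd.comp (continuous_subtype_val.comp (fromKify _).continuous)⟩⟩
  -- A point of `E` carries a path from `c₀` to `w(p(e))`; evaluating it at time `s` deforms the
  -- constant map into `w ∘ p`.
  exact ContinuousMap.Homotopic.symm
    ⟨{ toFun := fun x => e (x.2, x.1)
       continuous_toFun := by fun_prop
       map_zero_left := fun x => (kval x).2.1
       map_one_left := fun x => (kval x).2.2 }⟩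

variable {hB : HStructure B b₀} {hC : HStructure C c₀} {w : C(B, C)} (hw : w b₀ = c₀)
  {D : C(Smash (constLoop b₀) (constLoop b₀), FreeLoop C)}
  {d : C(Smash (basedConst b₀) b₀, BasedLoop C c₀)}

omit [IsGeneratedBy testFamily.{u} C] in
-- The smash product collapses this axis, and the reverse of a constant loop is constant. The
-- equality is strict, so in the main proof the restriction of `F` to one axis factors exactly
-- through the projection to `ΩB`.
lemma frakDPrime_base_left (hd : IsLoopLift D d) (e : HomotopyFibre w c₀) :
    frakDPrime w hw d (smashMk _ _ (kmk (basedConst b₀, e))) = basedConst c₀ := by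
  have h : smashMk (basedConst b₀) b₀ (kmk (basedConst b₀, fibreProj w c₀ e)) = smashBase _ _ :=
    Quot.sound ⟨Or.inl rfl, Or.inl rfl⟩
  change loopInv c₀ (d (smashMk (basedConst b₀) b₀ (kmk (basedConst b₀, fibreProj w c₀ e)))) = _
  rw [h, hd.base]
  exact congrArg kmk Path.refl_symm

/-- On `ΩB × E`, the map `Lw(λ · p(e))` is homotopic to the product of `𝔇'` and `Lw(λ)`. -/
lemma freeMap_prodToFree_homotopic (hassoc : hC.HomotopyAssoc) (hD : IsDeviation hB hC w D)
    (hd : IsLoopLift D d) :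
    ((freeMap w).comp ((prodToFree hB).comp (kpair kfst ((fibreProj w c₀).comp ksnd)))).Homotopic
      (loopMul hC.mul ((loopIncl c₀).comp ((frakDPrime w hw d).comp (smashMk _ _)))
        (((freeMap w).comp (loopIncl b₀)).comp kfst)) := by
  let r : C(KProd (BasedLoop B b₀) (HomotopyFibre w c₀), KProd (BasedLoop B b₀) B) :=
    kpair kfst ((fibreProj w c₀).comp ksnd)
  let k := d.comp ((smashMk (basedConst b₀) b₀).comp r)
  let φ := (freeMap w).comp ((prodToFree hB).comp r)
  let ψ : C(KProd (BasedLoop B b₀) (HomotopyFibre w c₀), FreeLoop C) :=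
    ((freeMap w).comp (loopIncl b₀)).comp kfst
  -- The deviation identity on `(i(λ), s(p(e)))`, with `D` replaced by its lift `d` and the factor
  -- `Lw(s(p(e)))` removed.
  have h₁ : (loopMul hC.mul ((loopIncl c₀).comp k) φ).Homotopic ψ := by
    have hi : ((loopIncl c₀).comp k).Homotopic
        (D.comp ((smashMk _ _).comp (kpair ((loopIncl b₀).comp kfst)
          (constLoop.comp ((fibreProj w c₀).comp ksnd))))) :=
      ContinuousMap.Homotopic.comp (hd.homotopic.homotopic)
        (ContinuousMap.Homotopic.refl ((smashMk (basedConst b₀) b₀).comp r))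
    have hdev : (loopMul hC.mul (D.comp ((smashMk _ _).comp (kpair ((loopIncl b₀).comp kfst)
        (constLoop.comp ((fibreProj w c₀).comp ksnd))))) φ).Homotopic
        (loopMul hC.mul ψ ((freeMap w).comp (constLoop.comp ((fibreProj w c₀).comp ksnd)))) := by
      have := ContinuousMap.Homotopic.comp hD.homotopic.homotopic
        (ContinuousMap.Homotopic.refl (kpair ((loopIncl b₀).comp (kfst (Y := HomotopyFibre w c₀)))
          (constLoop.comp ((fibreProj w c₀).comp ksnd))))
      exact this
    -- Since `Lw ∘ s = s ∘ w` holds by definition, it is enough to apply `s` to the null homotopy of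
    -- `w ∘ p`.
    have hnull : ((freeMap w).comp (constLoop.comp ((fibreProj w c₀).comp ksnd))).Homotopic
        (ContinuousMap.const (KProd (BasedLoop B b₀) (HomotopyFibre w c₀)) (constLoop c₀)) :=
      ContinuousMap.Homotopic.comp (ContinuousMap.Homotopic.refl constLoop)
        (ContinuousMap.Homotopic.comp (comp_fibreProj_homotopic w c₀)
          (ContinuousMap.Homotopic.refl ksnd))
    exact (loopMul_homotopic _ hi (.refl _)).trans <| hdev.trans <|
      (loopMul_homotopic _ (.refl _) hnull).trans (loopMul_const_right hC ψ)
  -- With `k'` the reverse of `k`: `φ ≃ 1 · φ ≃ (k' · k) · φ ≃ k' · (k · φ) ≃ k' · ψ`, and `k'` is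
  -- `𝔇'` by definition.
  exact (loopMul_const_left hC φ).symm.trans <|
    (loopMul_homotopic _ (loopMul_loopInv_self hC k).symm (.refl φ)).trans <|
    (loopMul_assoc hC hassoc _ _ φ).trans (loopMul_homotopic _ (.refl _) h₁)

end

end KSpace

/-! ### Passage to homology. -/

theorem mainTheorem7 {B C : Type u} [TopologicalSpace B] [TopologicalSpace C]
    [CompactlyGeneratedSpace B] [CompactlyGeneratedSpace C] {b₀ : B} {c₀ : C}
    (hB : HStructure B b₀) (hC : HStructure C c₀) (hassoc : hC.HomotopyAssoc)
    (w : C(B, C)) (hw : w b₀ = c₀)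
    (D : C(Smash (constLoop b₀) (constLoop b₀), FreeLoop C)) (hD : IsDeviation hB hC w D)
    (d : C(Smash (basedConst b₀) b₀, BasedLoop C c₀)) (hd : IsLoopLift D d)
    {r₁ r₂ : ℕ} (hr₁ : 0 < r₁) (hr₂ : 0 < r₂)
    (a : homologyZ r₁ (BasedLoop B b₀)) (ha : IsPrimitive (basedConst b₀) a)
    (b : homologyZ r₂ (HomotopyFibre w c₀)) (hb : IsPrimitive (fibreBase w hw) b) :
    homologyZMap (r₁ + r₂) (loopIncl c₀)
        (homologyZMap (r₁ + r₂) ((frakDPrime w hw d).comp (smashMk _ _)) (homologyCross a b)) =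
      homologyZMap (r₁ + r₂) (freeMap w)
        (homologyZMap (r₁ + r₂)
          ((prodToFree hB).comp (kpair kfst ((fibreProj w c₀).comp ksnd))) (homologyCross a b)) := by
  let f := (loopIncl c₀).comp
    ((frakDPrime w hw d).comp (smashMk (basedConst b₀) (fibreBase w hw)))
  let ψ := (freeMap w).comp (loopIncl b₀)
  -- The two occurrences of `λ` in `𝔇'(λ, e) · Lw(λ)` become independent variables, which exposes
  -- the diagonal of `ΩB`.
  let F : C(KProd (KProd (BasedLoop B b₀) (BasedLoop B b₀)) (HomotopyFibre w c₀), FreeLoop C) :=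
    loopMul hC.mul (f.comp (kpair (kfst.comp kfst) ksnd)) (ψ.comp (ksnd.comp kfst))
  have hdiag : ((freeMap w).comp ((prodToFree hB).comp
      (kpair kfst ((fibreProj w c₀).comp ksnd)))).Homotopic
        (F.comp (kpair (kpair kfst kfst) ksnd)) :=
    freeMap_prodToFree_homotopic hw hassoc hD hd
  have hleft : (F.comp (kpair (kpair kfst (ContinuousMap.const _ (basedConst b₀))) ksnd)).Homotopic
      f := by
    have e : F.comp (kpair (kpair kfst (ContinuousMap.const _ (basedConst b₀))) ksnd) =
        loopMul hC.mul f (ContinuousMap.const _ (freeMap w (constLoop b₀))) := rfl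
    have e' : freeMap w (constLoop b₀) = constLoop c₀ := by
      rw [← hw]
      rfl
    rw [e, e']
    exact loopMul_const_right hC f
  -- With the first loop constant, `𝔇'` contributes the constant loop and `e` no longer occurs.
  have hright : F.comp (kpair (kpair (ContinuousMap.const _ (basedConst b₀)) kfst) ksnd) =
      (loopMul hC.mul (ContinuousMap.const _ (constLoop c₀)) ψ).comp kfst := by
    ext x
    change freeMul hC.mul (kmk (loopIncl c₀ (frakDPrime w hw d
      (smashMk _ _ (kmk (basedConst b₀, ksnd x)))), ψ (kfst x))) = _
    rw [frakDPrime_base_left hw hd]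
    rfl
  rw [← homologyZMap_comp, ← homologyZMap_comp, homologyZMap_congr _ hdiag,
    ha.homologyZMap_homologyCross, homologyZMap_congr _ hleft, hright,
    homologyZMap_comp_kfst_homologyCross hr₂, add_zero]
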